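/- Let $F$ be a field, $t\in F$, and $q$ a formal variable. **Word quasi-symmetric functions.** A word over $\{1,2,\dots\}$ is packed if its set of letters is $\{1,\dots,k\}$ for some $k\ge 0$; $\mathrm{pack}(w)$ is obtained from a word $w$ over a totally ordered alphabet by replacing each occurrence of its $k$-th smallest letter by $k$. $\mathbf{WQSym}$ has the basis $\mathbf M_u(A)=\sum_{\mathrm{pack}(w)=u}w$ ($u$ packed). On its graded dual, with dual basis $(\mathbf N_u)$, the internal product is $\mathbf N_u*\mathbf N_v=\mathbf N_{\mathrm{pack}(u,v)}$ for $|u|=|v|$ (and $0$ if $|u|\ne|v|$), biwords being packed for the lexicographic order on the pairs $(u_i,v_i)$. Noncommutative symmetric functions are embedded in the dual by $S^I=\sum_{\mathrm{ev}(u)=I}\mathbf N_u$, where $\mathrm{ev}(u)$ lists the multiplicities of the letters $1,2,\dots$ of $u$. Put $\sigma_1((1-t)A)=\big(\sum_k(-t)^k\Lambda_k\big)\big(\sum_l S_l\big)$ with $\Lambda_k=\sum_{I\vDash k}(-1)^{k-\ell(I)}S^I$, and $\mathbf N_u((1-t)A)=\mathbf N_u*\sigma_1((1-t)A)$. The map $\mathbf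 M_u(A)\mapsto \mathbf M_u(A\cdot(1-t))$ is the adjoint of $\mathbf N_v(A)\mapsto\mathbf N_v((1-t)A)$, that is, the coefficient of $\mathbf M_v(A)$ in $\mathbf M_u(A\cdot(1-t))$ is the coefficient of $\mathbf N_u$ in $\mathbf N_v((1-t)A)$. For $f\in\mathbf{WQSym}$, $f(\mathbb X)\in F[[q]]$ is obtained from $f(A\cdot(1-t))$ by specializing $A$ to the alphabet $\frac1{1-q}=\{\cdots<q^2<q<1\}$, each word being replaced by the product of its letters. **Plane trees.** A plane tree here is a finite rooted plane tree in which every internal node has at least two children. A region is a part of the plane between two consecutive edges coming from the same vertex, so that a node of arity $a$ carries $a-1$ regions. The decreasing plane tree $\mathcal T(u)$ of a word $u$ is a single leaf if $u$ is empty; otherwise, if $m$ is the maximal letter of $u$ and $u=w_0\,m\,w_1\,m\cdots m\,w_k$ with no $m$ in the $w_j$, it is the tree whose root has the subtrees $\mathcal T(w_0),\dots,\mathcal T(w_k)$ in this order. The Loday–Ronco free tridendriform algebra of plane trees is embedded in $\mathbf{WQSym}$ by sending $T$ to $\mathbf M_T=\sum_{\mathcal T(u)=T}\mathbf M_u$,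 the sum being over packed words $u$. **Theorem.** Let $T$ be a plane tree with $n\ge 1$ regions and root $\rho$. Then, in $F[[q]]$, $$\mathbf M_T(\mathbb X)=\frac{1-t^{a(\rho)-1}}{1-q^n}\prod_{i\in\mathrm{Int}(T)}\frac{q^{r(i)}-t^{a(i)-1}}{1-q^{s(i)-1}},$$ where $\mathrm{Int}(T)$ is the set of internal nodes of $T$ other than the root, $a(i)$ is the arity of $i$, and $r(i)$ and $s(i)$ are the numbers of regions and of leaves, respectively, of the subtree of $T$ rooted at $i$ (so that $s(i)-1=r(i)$). -/

import Mathlib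

/-! ## Packed words -/

section PackedWords

/-- Packing of a word over a totally ordered alphabet: every occurrence of the `k`-th smallest
letter of `w` is replaced by `k`. -/
def packWord {α : Type*} [LinearOrder α] (w : List α) : List ℕ :=
  w.map fun a => (w.toFinset.filter (· ≤ a)).card

/-- A word over the positive integers is packed if its set of letters is `{1, …, k}`
for some `k` (`k = 0` for the empty word). -/
def IsPackedWord (w : List ℕ) : Prop :=
  ∃ k : ℕ, w.toFinset = Finset.Icc 1 k

theorem length_packWord {α : Type*} [LinearOrder α] (w : List α) :
    (packWord w).length = w.length := by
  simp [packWord]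

theorem isPackedWord_packWord {α : Type*} [LinearOrder α] (w : List α) :
    IsPackedWord (packWord w) := by
  refine ⟨w.toFinset.card, ?_⟩
  have himg : (packWord w).toFinset =
      w.toFinset.image fun a => (w.toFinset.filter (· ≤ a)).card := by
    ext x
    simp [packWord]
  rw [himg]
  generalize w.toFinset = s
  apply Finset.eq_of_subset_of_card_le
  · intro x hx
    obtain ⟨a, ha, rfl⟩ := Finset.mem_image.1 hx
    refine Finset.mem_Icc.2 ⟨?_, Finset.card_filter_le _ _⟩
    exact Finset.card_pos.2 ⟨a, Finset.mem_filter.2 ⟨ha, le_rfl⟩⟩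
  · rw [Finset.card_image_of_injOn]
    · simp
    · have key : ∀ a ∈ s, ∀ b ∈ s, a < b →
          (s.filter (· ≤ a)).card < (s.filter (· ≤ b)).card := by
        intro a _ b hb hab
        apply Finset.card_lt_card
        refine ⟨fun x hx => ?_, fun h => ?_⟩
        · have hx' := Finset.mem_filter.1 hx
          exact Finset.mem_filter.2 ⟨hx'.1, hx'.2.trans hab.le⟩
        · have hb' := h (Finset.mem_filter.2 ⟨hb, le_rfl⟩)
          exact absurd (Finset.mem_filter.1 hb').2 (not_le.2 hab)
      intro a ha b hb hab
      rcases lt_trichotomy a b with h | h | h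
      · exact absurd hab (key a ha b hb h).ne
      · exact h
      · exact absurd hab (key b hb a ha h).ne'

/-- The set of packed words. -/
abbrev PackedWord : Type := {w : List ℕ // IsPackedWord w}

/-- The packed word of a word, as an element of `PackedWord`. -/
def toPacked {α : Type*} [LinearOrder α] (w : List α) : PackedWord :=
  ⟨packWord w, isPackedWord_packWord w⟩

theorem finite_packedWords (n : ℕ) : {u : PackedWord | u.1.length = n}.Finite := by
  have hfin : {l : List (Fin (n + 1)) | l.length = n}.Finite := List.finite_length_eq _ n
  refine Set.Finite.of_finite_image ((hfin.image fun l => l.map Fin.val).subset ?_)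
    (f := Subtype.val) Subtype.val_injective.injOn
  rintro _ ⟨⟨u, k, hk⟩, hu, rfl⟩
  have hu' : u.length = n := hu
  have hkn : k ≤ n := by
    have h := List.toFinset_card_le u
    rw [hk, Nat.card_Icc] at h
    omega
  have hlt : ∀ a ∈ u, a < n + 1 := fun a ha => by
    have h := List.mem_toFinset.2 ha
    rw [hk, Finset.mem_Icc] at h
    omega
  refine ⟨u.pmap (fun a h => (⟨a, h⟩ : Fin (n + 1))) hlt, ?_, ?_⟩
  · simpa using hu'
  · simp [List.map_pmap]

/-- The packed words of length `n`. -/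
noncomputable def packedWords (n : ℕ) : Finset PackedWord := (finite_packedWords n).toFinset

/-- The evaluation `(|u|₁, …, |u|ₖ)` of a packed word with maximal letter `k`; it is a composition
of the length of `u`. -/
def PackedWord.ev (u : PackedWord) : List ℕ :=
  (List.range' 1 (u.1.foldr max 0)).map fun j => u.1.count j

end PackedWords

/-! ## Noncommutative symmetric functions -/

section NoncommutativeSymmetricFunctions

/-- The algebra `Sym` of noncommutative symmetric functions: the free associative algebra on
`S₁, S₂, …`; the basis element indexed by `I = (i₁, …, iᵣ)` is `S^I = S_{i₁} ⋯ S_{iᵣ}`. -/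
abbrev NCSym (F : Type*) [Field F] : Type _ := MonoidAlgebra F (FreeMonoid ℕ+)

/-- The complete function `Sₙ`, with `S₀ = 1`. -/
noncomputable def NCSym.S (F : Type*) [Field F] (n : ℕ) : NCSym F :=
  if h : 0 < n then MonoidAlgebra.single (FreeMonoid.of ⟨n, h⟩) 1 else 1

/-- The elementary function `Λₙ = ∑_{I ⊨ n} (-1)^{n - ℓ(I)} S^I`. -/
noncomputable def NCSym.Lam (F : Type*) [Field F] (n : ℕ) : NCSym F :=
  ∑ I : Composition n, (-1 : F) ^ (n - I.length) • (I.blocks.map (NCSym.S F)).prod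

/-- The component of degree `n` of
`σ₁((1-t)A) = λ_{-t}(A) σ₁(A) = (∑ₖ (-t)^k Λₖ) (∑ₗ Sₗ)`. -/
noncomputable def NCSym.sigmaOneMinus {F : Type*} [Field F] (t : F) (n : ℕ) : NCSym F :=
  ∑ k ∈ Finset.range (n + 1), (-t) ^ k • (NCSym.Lam F k * NCSym.S F (n - k))

end NoncommutativeSymmetricFunctions

/-! ## Word quasi-symmetric functions -/

section WordQuasiSymmetricFunctions

/-- `WQSym`, through the coordinates in its basis `(M_u)` indexed by packed words. -/
abbrev WQSym (F : Type*) [Field F] : Type _ := PackedWord →₀ F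

/-- The graded dual `WQSym*`, through the coordinates in the basis `(N_u)` dual to `(M_u)`. -/
abbrev WQSymDual (F : Type*) [Field F] : Type _ := PackedWord →₀ F

/-- The basis element `M_u`. -/
noncomputable def WQSym.M (F : Type*) [Field F] (u : PackedWord) : WQSym F := Finsupp.single u 1

/-- The basis element `N_u`. -/
noncomputable def WQSymDual.N (F : Type*) [Field F] (u : PackedWord) : WQSymDual F :=
  Finsupp.single u 1

/-- The realization `M_u(A) = ∑_{pack(w) = u} w` of `M_u` over an ordered alphabet `A`, as a formal
sum of words: the value at `w` is the coefficient of the word `w`. -/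
def WQSym.realM (F : Type*) [Field F] (A : Type*) [LinearOrder A] (u : PackedWord) :
    List A → F :=
  fun w => if toPacked w = u then 1 else 0

/-- The internal product of `WQSym*`: `N_u * N_v = N_{pack(u,v)}` if `u` and `v` have the same
length, and `0` otherwise, where the letters `(uᵢ, vᵢ)` of the biword are ordered
lexicographically. -/
noncomputable def WQSymDual.internalMul {F : Type*} [Field F] (f g : WQSymDual F) : WQSymDual F :=
  f.sum fun u a => g.sum fun v b =>
    if u.1.length = v.1.length then
      (a * b) • WQSymDual.N F (toPacked (List.zipWith (fun x y => toLex (x, y)) u.1 v.1))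
    else 0

/-- The embedding of `Sym` in `WQSym*` given by `S^I = ∑_{ev(u) = I} N_u`. -/
noncomputable def NCSym.toWQSymDual (F : Type*) [Field F] : NCSym F → WQSymDual F :=
  fun f => f.coeff.sum fun I a =>
    a • ∑ u ∈ packedWords ((I.toList.map fun i : ℕ+ => (i : ℕ)).sum) with
      u.ev = I.toList.map (fun i : ℕ+ => (i : ℕ)), WQSymDual.N F u

/-- `N_u((1-t)A) = N_u(A) * σ₁((1-t)A)`. -/
noncomputable def WQSymDual.NOneMinus {F : Type*} [Field F] (t : F) (u : PackedWord) :
    WQSymDual F :=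
  WQSymDual.internalMul (WQSymDual.N F u)
    (NCSym.toWQSymDual F (NCSym.sigmaOneMinus t u.1.length))

/-- The adjoint `f(A) ↦ f(A·(1-t))` on `WQSym` of the degree-preserving map
`N_v(A) ↦ N_v((1-t)A)` of `WQSym*`: the coefficient of `M_v(A)` in `M_u(A·(1-t))` is the
coefficient of `N_u(A)` in `N_v((1-t)A)`. -/
noncomputable def WQSym.timesOneMinus {F : Type*} [Field F] (t : F) : WQSym F →ₗ[F] WQSym F :=
  Finsupp.linearCombination F fun u =>
    ∑ v ∈ packedWords u.1.length, (WQSymDual.NOneMinus t v) u • WQSym.M F v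

/-- The specialization `A = 1/(1-q) = {⋯ < q² < q < 1}`: every letter of every word of `f(A)` is
replaced by the corresponding power of the formal variable `q` (the variable `X` of `F⟦X⟧`).
The letter `q^i` is represented by `i : ℕᵒᵈ`, since `q^i < q^j` in the alphabet iff `i > j`;
the sum below runs over the words `q^{w 0} q^{w 1} ⋯` of length `|u|` whose product is `q^m`. -/
noncomputable def WQSym.atGeometric (F : Type*) [Field F] : WQSym F →ₗ[F] PowerSeries F :=
  Finsupp.linearCombination F fun u => PowerSeries.mk fun m =>
    ∑ w ∈ Finset.Nat.antidiagonalTuple u.1.length m,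
      WQSym.realM F ℕᵒᵈ u (List.ofFn fun i => OrderDual.toDual (w i))

/-- The specialization `f(𝕏)`, `𝕏 = 1/(1-q) ×̂ (1-t)`: take `A = 1/(1-q)` in `f(A·(1-t))`. -/
noncomputable def WQSym.atX {F : Type*} [Field F] (t : F) : WQSym F →ₗ[F] PowerSeries F :=
  WQSym.atGeometric F ∘ₗ WQSym.timesOneMinus t

end WordQuasiSymmetricFunctions

/-! ## Plane trees -/

/-- Plane trees in which every internal node has at least two children: `node k c` has a root with
the `k + 2` ordered subtrees `c 0, …, c (k + 1)`. -/
inductive PlaneTree : Type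
  | leaf : PlaneTree
  | node (k : ℕ) (c : Fin (k + 2) → PlaneTree) : PlaneTree

namespace PlaneTree

/-- The arity of the root. -/
def arity : PlaneTree → ℕ
  | leaf => 0
  | node k _ => k + 2

/-- The number of regions (parts of the plane between two consecutive edges coming from the same
vertex): a vertex of arity `a` carries `a - 1` regions. -/
def regions : PlaneTree → ℕ
  | leaf => 0
  | node k c => (k + 1) + ∑ i, (c i).regions

/-- The number of leaves. -/
def leaves : PlaneTree → ℕ
  | leaf => 1
  | node _ c => ∑ i, (c i).leaves

/-- The subtrees rooted at the internal nodes (root included), one for each node. -/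
def internalNodes : PlaneTree → Multiset PlaneTree
  | leaf => 0
  | node k c => node k c ::ₘ ∑ i, (c i).internalNodes

/-- The subtrees rooted at the internal nodes other than the root, one for each node. -/
def properInternalNodes : PlaneTree → Multiset PlaneTree
  | leaf => 0
  | node _ c => ∑ i, (c i).internalNodes

theorem length_splitOn_getD_lt {u : List ℕ} {m : ℕ} (h : m ∈ u) (i : ℕ) :
    ((u.splitOn m).getD i []).length < u.length := by
  induction u generalizing i with
  | nil => simp at h
  | cons a l ih =>
    have hle : ∀ j, ((l.splitOn m).getD j []).length ≤ l.length := by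
      intro j
      by_cases hm : m ∈ l
      · exact (ih hm j).le
      · rw [List.splitOn_eq_singleton hm]
        cases j <;> simp
    rw [List.splitOn_cons_eq_if_modifyHead]
    by_cases ha : a = m
    · subst ha
      cases i with
      | zero => simp
      | succ i => simpa [Nat.lt_succ_iff] using hle i
    · have hl : m ∈ l := by
        rcases List.mem_cons.1 h with h' | h'
        · exact absurd h'.symm ha
        · exact h'
      have hlt := ih hl i
      have hne := List.splitOn_ne_nil m l
      rw [if_neg (by simpa using ha)]
      revert hlt hne
      generalize l.splitOn m = L
      intro hlt hne
      cases L with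
      | nil => exact absurd rfl hne
      | cons p ps =>
        cases i with
        | zero => simpa using hlt
        | succ i => simpa using Nat.lt_succ_of_lt hlt

/-- The decreasing plane tree of a word: a leaf for the empty word; otherwise, if `m` is the maximal
letter and `u = w₀ m w₁ m ⋯ m w_{k+1}` with no `m` in the `wᵢ`, a root with the `k + 2` subtrees
associated with `w₀, …, w_{k+1}`. -/
def decreasing (u : List ℕ) : PlaneTree :=
  match h : u.max? with
  | none => leaf
  | some m => node (u.count m - 1) fun i => decreasing ((u.splitOn m).getD i [])
termination_by u.length
decreasing_by exact length_splitOn_getD_lt (List.max?_mem h) i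

open Classical in
/-- The element `M_T = ∑_{𝒯(u) = T} M_u` of `WQSym`, the sum being over the packed words `u` whose
decreasing plane tree is `T` (their length is the number of regions of `T`). -/
noncomputable def MT (F : Type*) [Field F] (T : PlaneTree) : WQSym F :=
  ∑ u ∈ packedWords T.regions with decreasing u.1 = T, WQSym.M F u

end PlaneTree

/-!
On a packed word with `h` levels and `ℓ` occurrences of its largest letter, the coefficient of
`σ₁((1-t)A)` is `(-1)^h (t^n - t^(n-ℓ))`. A word of exponents attached to the regions of `T`
contributes to `M_T(𝕏)` only if it is constant on the regions of each node and weakly increasing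
from the root to the leaves. For such a labeling `ξ` of the internal nodes, the contribution is a
signed sum over all ordered set partitions of the nodes in which a node strictly precedes each
ancestor with the same label. Peeling off the last block turns this sum into an inclusion–exclusion,
with value `∏ (1 - t^(a-1))` over the nodes without ancestor of the same label times
`∏ (-t^(a-1))` over the others.

Now replace `ξ` by its successive differences `d` along the edges. The exponent of `q` becomes
`∑ r(i) d(i)` and the factor of a node other than the root depends only on whether its own
difference vanishes, so the sum over all `d` is a product of geometric series in `q^r(i)`:
`-a + (1 - a) (x + x² + ⋯) = (x - a) / (1 - x)`.
-/

section Powerset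

variable {α K : Type*} [DecidableEq α] [CommRing K] {s M : Finset α}

theorem sum_powerset_prod_sdiff_neg (hM : M ⊆ s) (τ : α → K) :
    ∑ S ∈ M.powerset, ∏ x ∈ s \ S, -τ x = ∏ x ∈ s, if x ∈ M then 1 - τ x else -τ x := by
  have hsplit : ∀ x, (if x ∈ M then 1 - τ x else -τ x) = (if x ∈ M then 1 else 0) + -τ x := by
    intro x
    split_ifs <;> ring
  have hpowerset : s.powerset.filter (· ⊆ M) = M.powerset := by
    ext S
    simpa using fun hS : S ⊆ M => hS.trans hM
  simp only [hsplit, Finset.prod_add, Finset.prod_ite_zero, Finset.prod_const_one, ite_mul, one_mul,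
    zero_mul, ← Finset.subset_iff, ← Finset.sum_filter, hpowerset]

theorem sum_powerset_neg_one_pow_card_sdiff (hM : M ⊆ s) (hne : M.Nonempty) :
    ∑ S ∈ M.powerset, (-1 : K) ^ (s \ S).card = 0 := by
  obtain ⟨x, hx⟩ := hne
  have h := sum_powerset_prod_sdiff_neg hM fun _ => (1 : K)
  rw [Finset.prod_eq_zero (hM hx) (by rw [if_pos hx, sub_self])] at h
  simpa only [Finset.prod_const] using h

end Powerset

section StrictPackings

variable {α : Type*} {R : α → α → Prop} {s : Finset α} {ω : α → ℕ}

/-- The elements of `s` which are related by `R` to no element of `s`: the candidates for the top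
level of a strict packing of `s`. -/
noncomputable def maximals (R : α → α → Prop) (s : Finset α) : Finset α :=
  open Classical in s.filter fun x => ∀ y ∈ s, ¬ R x y

theorem mem_maximals {x : α} : x ∈ maximals R s ↔ x ∈ s ∧ ∀ y ∈ s, ¬ R x y := by
  simp [maximals]

theorem maximals_subset (R : α → α → Prop) (s : Finset α) : maximals R s ⊆ s :=
  fun _ hx => (mem_maximals.1 hx).1

theorem maximals_nonempty (hR : WellFounded (Function.swap R)) (hs : s.Nonempty) :
    (maximals R s).Nonempty := by
  obtain ⟨x, hx, hmax⟩ := hR.has_min (s : Set α) hs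
  exact ⟨x, mem_maximals.2 ⟨hx, hmax⟩⟩

variable [Fintype α]

/-- The largest value of a labeling: the number of levels of a packing. -/
def height (ω : α → ℕ) : ℕ := Finset.univ.sup ω

theorem le_height (ω : α → ℕ) (x : α) : ω x ≤ height ω := Finset.le_sup (Finset.mem_univ x)

/-- The elements carrying the largest value of a labeling. -/
def topLevel (ω : α → ℕ) : Finset α := {x | ω x = height ω}

theorem mem_topLevel {x : α} : x ∈ topLevel ω ↔ ω x = height ω := by simp [topLevel]

theorem height_eq_of_image_eq_Icc (hzero : ∀ x ∉ s, ω x = 0) {k : ℕ}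
    (hk : s.image ω = Finset.Icc 1 k) : height ω = k := by
  apply le_antisymm
  · refine Finset.sup_le fun x _ => ?_
    by_cases hx : x ∈ s
    · exact (Finset.mem_Icc.1 (hk ▸ Finset.mem_image_of_mem ω hx)).2
    · simp [hzero x hx]
  · rcases Nat.eq_zero_or_pos k with rfl | hpos
    · exact Nat.zero_le _
    · obtain ⟨x, -, rfl⟩ := Finset.mem_image.1 (hk ▸ Finset.mem_Icc.2 ⟨hpos, le_rfl⟩)
      exact le_height ω x

/-- A strict packing of `s`: a labeling taking on `s` exactly the values `1, …, k` for some `k`,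
strictly increasing for the relation `R`. It is extended by `0` outside `s`, so that the packings
of all the subsets of `α` are functions of the same type. -/
structure IsStrictPacking (R : α → α → Prop) (s : Finset α) (ω : α → ℕ) : Prop where
  eq_zero : ∀ x ∉ s, ω x = 0
  image_eq : s.image ω = Finset.Icc 1 (height ω)
  lt_of_rel : ∀ x ∈ s, ∀ y ∈ s, R x y → ω x < ω y

namespace IsStrictPacking

theorem mem_Icc (h : IsStrictPacking R s ω) {x : α} (hx : x ∈ s) :
    ω x ∈ Finset.Icc 1 (height ω) :=
  h.image_eq ▸ Finset.mem_image_of_mem ω hx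

theorem exists_eq (h : IsStrictPacking R s ω) {j : ℕ} (hj : j ∈ Finset.Icc 1 (height ω)) :
    ∃ x ∈ s, ω x = j :=
  Finset.mem_image.1 (h.image_eq ▸ hj)

theorem height_pos (h : IsStrictPacking R s ω) (hs : s.Nonempty) : 0 < height ω := by
  obtain ⟨x, hx⟩ := hs
  have := Finset.mem_Icc.1 (h.mem_Icc hx)
  omega

theorem topLevel_nonempty (h : IsStrictPacking R s ω) (hs : s.Nonempty) :
    (topLevel ω).Nonempty := by
  obtain ⟨x, -, hx⟩ := h.exists_eq (Finset.mem_Icc.2 ⟨h.height_pos hs, le_rfl⟩)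
  exact ⟨x, mem_topLevel.2 hx⟩

theorem topLevel_subset_maximals (h : IsStrictPacking R s ω) (hs : s.Nonempty) :
    topLevel ω ⊆ maximals R s := by
  intro x hx
  rw [mem_topLevel] at hx
  have hxs : x ∈ s := by
    by_contra hxs
    have := h.height_pos hs
    have := h.eq_zero x hxs
    omega
  refine mem_maximals.2 ⟨hxs, fun y hy hxy => ?_⟩
  have := h.lt_of_rel x hxs y hy hxy
  have := le_height ω y
  omega

end IsStrictPacking

theorem isStrictPacking_empty_iff : IsStrictPacking R ∅ ω ↔ ω = 0 := by
  constructor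
  · exact fun h => funext fun x => h.eq_zero x (Finset.notMem_empty x)
  · rintro rfl
    exact ⟨fun _ _ => rfl, by simp [height], by simp⟩

variable [DecidableEq α] {S : Finset α}

/-- The extension of a packing by a new top level `S`. -/
def addTop (S : Finset α) (ω : α → ℕ) : α → ℕ :=
  fun x => if x ∈ S then height ω + 1 else ω x

theorem height_addTop (hS : S.Nonempty) (ω : α → ℕ) : height (addTop S ω) = height ω + 1 := by
  obtain ⟨x, hx⟩ := hS
  apply le_antisymm
  · refine Finset.sup_le fun y _ => ?_
    have := le_height ω y
    unfold addTop
    split_ifs <;> omega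
  · simpa [addTop, hx] using le_height (addTop S ω) x

theorem topLevel_addTop (hS : S.Nonempty) (ω : α → ℕ) : topLevel (addTop S ω) = S := by
  ext x
  rw [mem_topLevel, height_addTop hS, addTop]
  have := le_height ω x
  split_ifs with hx
  · simp [hx]
  · simp only [hx, iff_false]
    omega

theorem image_addTop (hSs : S ⊆ s) (hS : S.Nonempty) (ω : α → ℕ) :
    s.image (addTop S ω) = insert (height ω + 1) ((s \ S).image ω) := by
  have hcompl : (s \ S).image (addTop S ω) = (s \ S).image ω :=
    Finset.image_congr fun x hx => if_neg (Finset.mem_sdiff.1 (Finset.mem_coe.1 hx)).2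
  have htop : S.image (addTop S ω) = {height ω + 1} :=
    (Finset.image_congr fun x hx => if_pos (Finset.mem_coe.1 hx)).trans (Finset.image_const hS _)
  conv_lhs => rw [← Finset.sdiff_union_of_subset hSs, Finset.image_union]
  rw [hcompl, htop, Finset.union_comm, Finset.insert_eq]

theorem IsStrictPacking.addTop (hSM : S ⊆ maximals R s) (hS : S.Nonempty)
    (h : IsStrictPacking R (s \ S) ω) : IsStrictPacking R s (addTop S ω) where
  eq_zero x hx := by
    rw [_root_.addTop, if_neg fun hxS => hx (maximals_subset R s (hSM hxS))]
    exact h.eq_zero x fun hx' => hx (Finset.mem_sdiff.1 hx').1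
  image_eq := by
    rw [image_addTop (hSM.trans (maximals_subset R s)) hS, height_addTop hS, h.image_eq,
      Finset.insert_Icc_right_eq_Icc_add_one (by omega)]
  lt_of_rel x hx y hy hxy := by
    have hxS : x ∉ S := fun hxS => (mem_maximals.1 (hSM hxS)).2 y hy hxy
    simp only [_root_.addTop, if_neg hxS]
    split_ifs with hyS
    · exact Nat.lt_succ_of_le (le_height ω x)
    · exact h.lt_of_rel x (by simp [hx, hxS]) y (by simp [hy, hyS]) hxy

/-- The packing obtained by deleting the top level. -/
def removeTop (ω : α → ℕ) : α → ℕ := fun x => if x ∈ topLevel ω then 0 else ω x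

theorem removeTop_addTop (hS : S.Nonempty) (h : ∀ x ∈ S, ω x = 0) :
    removeTop (addTop S ω) = ω := by
  funext x
  rw [removeTop, topLevel_addTop hS, addTop]
  split_ifs with hx
  · exact (h x hx).symm
  · rfl

namespace IsStrictPacking

theorem image_removeTop (h : IsStrictPacking R s ω) :
    (s \ topLevel ω).image (removeTop ω) = Finset.Icc 1 (height ω - 1) := by
  have hcongr : (s \ topLevel ω).image (removeTop ω) = (s \ topLevel ω).image ω :=
    Finset.image_congr fun x hx => if_neg (Finset.mem_sdiff.1 (Finset.mem_coe.1 hx)).2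
  rw [hcongr]
  ext j
  simp only [Finset.mem_image, Finset.mem_sdiff, mem_topLevel, Finset.mem_Icc]
  constructor
  · rintro ⟨x, ⟨hxs, hx⟩, rfl⟩
    have := Finset.mem_Icc.1 (h.mem_Icc hxs)
    omega
  · intro hj
    obtain ⟨x, hxs, rfl⟩ := h.exists_eq (j := j) (Finset.mem_Icc.2 (by omega))
    exact ⟨x, ⟨hxs, by omega⟩, rfl⟩

theorem removeTop_eq_zero (h : IsStrictPacking R s ω) {x : α} (hx : x ∉ s \ topLevel ω) :
    removeTop ω x = 0 := by
  rw [Finset.mem_sdiff, not_and, not_not] at hx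
  rw [_root_.removeTop, ite_eq_left_iff]
  exact fun hx' => h.eq_zero x fun hxs => hx' (hx hxs)

theorem height_removeTop (h : IsStrictPacking R s ω) : height (removeTop ω) = height ω - 1 :=
  height_eq_of_image_eq_Icc (fun _ => h.removeTop_eq_zero) h.image_removeTop

theorem removeTop (h : IsStrictPacking R s ω) :
    IsStrictPacking R (s \ topLevel ω) (removeTop ω) where
  eq_zero _ := h.removeTop_eq_zero
  image_eq := by rw [h.image_removeTop, h.height_removeTop]
  lt_of_rel x hx y hy hxy := by
    rw [Finset.mem_sdiff] at hx hy
    rw [_root_.removeTop, _root_.removeTop, if_neg hx.2, if_neg hy.2]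
    exact h.lt_of_rel x hx.1 y hy.1 hxy

theorem addTop_removeTop (h : IsStrictPacking R s ω) (hs : s.Nonempty) :
    _root_.addTop (topLevel ω) (_root_.removeTop ω) = ω := by
  funext x
  rw [_root_.addTop, h.height_removeTop, Nat.sub_add_cancel (h.height_pos hs), _root_.removeTop]
  split_ifs with hx
  · exact (mem_topLevel.1 hx).symm
  · rfl

end IsStrictPacking

/-- The finset of the strict packings of `s`. -/
noncomputable def strictPackings (R : α → α → Prop) (s : Finset α) : Finset (α → ℕ) :=
  open Classical in
  (Fintype.piFinset fun _ => Finset.range (s.card + 1)).filter (IsStrictPacking R s)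

theorem mem_strictPackings : ω ∈ strictPackings R s ↔ IsStrictPacking R s ω := by
  simp only [strictPackings, Finset.mem_filter, Fintype.mem_piFinset, Finset.mem_range,
    and_iff_right_iff_imp]
  intro h x
  have hcard := Finset.card_image_le (s := s) (f := ω)
  rw [h.image_eq, Nat.card_Icc] at hcard
  have := le_height ω x
  omega

theorem sum_strictPackings_eq_sum_topLevel {β : Type*} [AddCommMonoid β] (hs : s.Nonempty)
    (f : (α → ℕ) → β) :
    ∑ ω ∈ strictPackings R s, f ω =
      ∑ S ∈ (maximals R s).powerset.erase ∅, ∑ ω ∈ strictPackings R (s \ S), f (addTop S ω) := by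
  rw [Finset.sum_sigma']
  refine Finset.sum_bij' (fun ω _ => ⟨topLevel ω, removeTop ω⟩) (fun p _ => addTop p.1 p.2)
    ?_ ?_ ?_ ?_ ?_ <;>
    simp only [Finset.mem_sigma, Finset.mem_erase, Finset.mem_powerset, mem_strictPackings, ne_eq,
      ← Finset.nonempty_iff_ne_empty, and_imp, Sigma.forall]
  · exact fun ω h =>
      ⟨⟨h.topLevel_nonempty hs, h.topLevel_subset_maximals hs⟩, h.removeTop⟩
  · exact fun S ω hS hSM h => h.addTop hSM hS
  · exact fun ω h => h.addTop_removeTop hs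
  · intro S ω hS _ h
    rw [topLevel_addTop hS, removeTop_addTop hS fun x hx => h.eq_zero x (by simp [hx])]
  · intro ω h
    rw [h.addTop_removeTop hs]

variable {K : Type*} [CommRing K]

theorem sum_strictPackings_neg_one_pow_height (hR : WellFounded (Function.swap R))
    (s : Finset α) : ∑ ω ∈ strictPackings R s, (-1 : K) ^ height ω = (-1) ^ s.card := by
  induction s using Finset.strongInduction with
  | H s ih =>
    rcases s.eq_empty_or_nonempty with rfl | hs
    · have hsingleton : strictPackings R (∅ : Finset α) = {0} := by
        ext ω
        rw [mem_strictPackings, isStrictPacking_empty_iff, Finset.mem_singleton]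
      have hheight : height (0 : α → ℕ) = 0 := Nat.le_zero.1 (Finset.sup_le fun _ _ => le_rfl)
      rw [hsingleton, Finset.sum_singleton, hheight, Finset.card_empty]
    · have hsum := sum_powerset_neg_one_pow_card_sdiff (K := K) (maximals_subset R s)
        (maximals_nonempty hR hs)
      rw [← Finset.add_sum_erase _ _ (Finset.empty_mem_powerset _), Finset.sdiff_empty] at hsum
      rw [sum_strictPackings_eq_sum_topLevel hs, eq_neg_of_add_eq_zero_left hsum,
        ← Finset.sum_neg_distrib]
      refine Finset.sum_congr rfl fun S hS => ?_
      rw [Finset.mem_erase, Finset.mem_powerset, ← Finset.nonempty_iff_ne_empty] at hS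
      simp only [height_addTop hS.1, pow_succ, mul_neg_one, Finset.sum_neg_distrib]
      rw [ih _ (Finset.sdiff_ssubset (hS.2.trans (maximals_subset R s)) hS.1)]

theorem sum_strictPackings_neg_one_pow_mul_sub (hR : WellFounded (Function.swap R))
    (hs : s.Nonempty) (τ : α → K) :
    ∑ ω ∈ strictPackings R s,
        (-1) ^ height ω * (∏ x ∈ s, τ x - ∏ x ∈ s \ topLevel ω, τ x) =
      ∏ x ∈ s, if x ∈ maximals R s then 1 - τ x else -τ x := by
  have hlevel : ∀ S ∈ (maximals R s).powerset.erase ∅, ∑ ω ∈ strictPackings R (s \ S),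
      (-1) ^ height (addTop S ω) * (∏ x ∈ s, τ x - ∏ x ∈ s \ topLevel (addTop S ω), τ x) =
        ∏ x ∈ s \ S, -τ x - (-1) ^ (s \ S).card * ∏ x ∈ s, τ x := by
    intro S hS
    have hne : S.Nonempty := Finset.nonempty_iff_ne_empty.2 (Finset.ne_of_mem_erase hS)
    simp only [topLevel_addTop hne, height_addTop hne, pow_succ, ← Finset.sum_mul]
    rw [sum_strictPackings_neg_one_pow_height hR, Finset.prod_neg]
    ring
  -- The term of the empty level is `0`, so that it can be added to the sum.
  rw [sum_strictPackings_eq_sum_topLevel hs, Finset.sum_congr rfl hlevel,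
    Finset.sum_erase _ (by simp [Finset.prod_neg]), Finset.sum_sub_distrib, ← Finset.sum_mul,
    sum_powerset_neg_one_pow_card_sdiff (maximals_subset R s) (maximals_nonempty hR hs),
    zero_mul, sub_zero, sum_powerset_prod_sdiff_neg (maximals_subset R s)]

end StrictPackings

section Intercalate

variable {A B : Type*}

theorem map_intercalate_singleton (f : A → B) (a : A) (L : List (List A)) :
    ([a].intercalate L).map f = [f a].intercalate (L.map (List.map f)) := by
  induction L with
  | nil => simp
  | cons l L ih => cases L <;> simp_all

theorem mem_intercalate_singleton {a b : A} {L : List (List A)} :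
    b ∈ [a].intercalate L ↔ (∃ l ∈ L, b ∈ l) ∨ b = a ∧ 2 ≤ L.length := by
  induction L with
  | nil => simp
  | cons l L ih =>
    cases L with
    | nil => simp
    | cons l' L =>
      by_cases hb : b = a <;> simp_all [List.intercalate_cons_cons]

theorem sum_intercalate_singleton [AddCommMonoid A] (a : A) (L : List (List A)) :
    ([a].intercalate L).sum = (L.map List.sum).sum + (L.length - 1) • a := by
  induction L with
  | nil => simp
  | cons l L ih =>
    cases L with
    | nil => simp
    | cons l' L =>
      rw [List.intercalate_cons_cons, List.sum_append, ih]
      simp only [List.map_cons, List.sum_append, List.sum_cons, List.sum_nil, List.length_cons,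
        Nat.add_sub_cancel, add_nsmul, one_nsmul]
      abel

theorem count_intercalate_singleton [DecidableEq A] (a : A) {L : List (List A)}
    (h : ∀ l ∈ L, a ∉ l) : ([a].intercalate L).count a = L.length - 1 := by
  induction L with
  | nil => simp
  | cons l L ih =>
    cases L with
    | nil => simpa [List.count_eq_zero] using h
    | cons l' L =>
      have hl : l.count a = 0 := List.count_eq_zero.2 (h l List.mem_cons_self)
      rw [List.intercalate_cons_cons, List.count_append, List.count_append, hl,
        ih fun x hx => h x (List.mem_cons_of_mem _ hx)]
      simp [add_comm]

theorem exists_eq_intercalate_singleton (a : A) (u : List A) :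
    ∃ L : List (List A), (∀ l ∈ L, a ∉ l) ∧ u = [a].intercalate L := by
  suffices ∃ l L, (∀ l' ∈ l :: L, a ∉ l') ∧ u = [a].intercalate (l :: L) by
    obtain ⟨l, L, h⟩ := this
    exact ⟨l :: L, h⟩
  induction u with
  | nil => exact ⟨[], [], by simp⟩
  | cons b u ih =>
    obtain ⟨l, L, hL, rfl⟩ := ih
    by_cases hb : b = a
    · subst hb
      exact ⟨[], l :: L, by simpa using hL, by simp⟩
    · refine ⟨b :: l, L, ?_, by rw [List.intercalate_cons_cons_left]⟩
      simpa [Ne.symm hb] using hL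

theorem exists_eq_intercalate_ofFn_of_isMax [LinearOrder A] {u : List A} {m : A} (hm : m ∈ u)
    (hmax : ∀ a ∈ u, a ≤ m) :
    ∃ (k : ℕ) (w : Fin (k + 2) → List A), (∀ i, ∀ a ∈ w i, a < m) ∧
      u = [m].intercalate (List.ofFn w) := by
  obtain ⟨L, hL, rfl⟩ := exists_eq_intercalate_singleton m u
  have hlen : 2 ≤ L.length := by
    rcases mem_intercalate_singleton.1 hm with ⟨l, hl, hml⟩ | ⟨-, h⟩
    · exact absurd hml (hL l hl)
    · exact h
  obtain ⟨k, hk⟩ := Nat.exists_eq_add_of_le' hlen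
  obtain ⟨w, rfl⟩ : ∃ w : Fin (k + 2) → List A, L = List.ofFn w :=
    ⟨fun i => L[i], by simp [← hk]⟩
  refine ⟨k, w, fun i a ha => ?_, rfl⟩
  have hwi : w i ∈ List.ofFn w := List.mem_ofFn.2 ⟨i, rfl⟩
  refine lt_of_le_of_ne (hmax a (mem_intercalate_singleton.2 (Or.inl ⟨w i, hwi, ha⟩))) ?_
  rintro rfl
  exact hL _ hwi ha

end Intercalate

theorem zipWith_toLex_eq_map_iff {ι A B : Type*} {x : List A} {w : List B}
    (h : x.length = w.length) {l : List ι} {f : ι → A ×ₗ B} :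
    List.zipWith (fun a b => toLex (a, b)) x w = l.map f ↔
      x = l.map (fun i => (ofLex (f i)).1) ∧ w = l.map fun i => (ofLex (f i)).2 := by
  induction l generalizing x w with
  | nil => cases x <;> cases w <;> simp_all
  | cons i l ih =>
    have hhead : ∀ a b, toLex (a, b) = f i ↔ a = (ofLex (f i)).1 ∧ b = (ofLex (f i)).2 :=
      fun a b => Prod.ext_iff
    cases x <;> cases w <;> simp_all [and_and_and_comm]

theorem strictMonoOn_card_filter_le {A : Type*} [LinearOrder A] (s : Finset A) :
    StrictMonoOn (fun a => (s.filter (· ≤ a)).card) s := by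
  intro a _ b hb hab
  refine Finset.card_lt_card (Finset.ssubset_iff_of_subset ?_ |>.2 ⟨b, ?_, ?_⟩)
  · exact Finset.monotone_filter_right s fun x _ hx => hx.trans hab.le
  · exact Finset.mem_filter.2 ⟨hb, le_rfl⟩
  · simp [hab]

theorem prod_map_multisetSum {ι A M : Type*} [CommMonoid M] (f : A → M) (s : Finset ι)
    (m : ι → Multiset A) : ((∑ i ∈ s, m i).map f).prod = ∏ i ∈ s, ((m i).map f).prod := by
  rw [← Multiset.coe_mapAddMonoidHom, map_sum, Multiset.prod_sum]

namespace PlaneTree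

/-- The internal nodes of a plane tree. -/
inductive Node : PlaneTree → Type
  | root (k : ℕ) (c : Fin (k + 2) → PlaneTree) : Node (node k c)
  | child {k : ℕ} {c : Fin (k + 2) → PlaneTree} (i : Fin (k + 2)) (x : Node (c i)) :
      Node (node k c)

namespace Node

/-- The subtree rooted at a node. -/
def subtree : {T : PlaneTree} → Node T → PlaneTree
  | _, root k c => node k c
  | _, child _ x => x.subtree

/-- The number `a - 1` of regions carried by a node of arity `a`. -/
def weight {T : PlaneTree} (x : Node T) : ℕ := x.subtree.arity - 1

/-- The distance of a node to the root. -/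
def depth : {T : PlaneTree} → Node T → ℕ
  | _, root _ _ => 0
  | _, child _ x => x.depth + 1

/-- `Below x y`: the node `x` is a proper descendant of `y`. -/
inductive Below : {T : PlaneTree} → Node T → Node T → Prop
  | root {k : ℕ} {c : Fin (k + 2) → PlaneTree} (i : Fin (k + 2)) (x : Node (c i)) :
      Below (child i x) (root k c)
  | child {k : ℕ} {c : Fin (k + 2) → PlaneTree} {i : Fin (k + 2)} {x y : Node (c i)} :
      Below x y → Below (child (c := c) i x) (child i y)

theorem Below.depth_lt {T : PlaneTree} {x y : Node T} (h : Below x y) : y.depth < x.depth := by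
  induction h with
  | root i x => exact Nat.succ_pos _
  | child _ ih => exact Nat.succ_lt_succ ih

theorem wellFounded_swap_below (T : PlaneTree) :
    WellFounded (Function.swap (Below : Node T → Node T → Prop)) :=
  Subrelation.wf Below.depth_lt (measure depth).wf

theorem forall_below_node_iff {k : ℕ} {c : Fin (k + 2) → PlaneTree}
    {P : Node (node k c) → Node (node k c) → Prop} :
    (∀ x y, Below x y → P x y) ↔ ∀ i, (∀ x : Node (c i), P (child i x) (root k c)) ∧
      ∀ x y : Node (c i), Below x y → P (child i x) (child i y) := by
  constructor
  · exact fun h i => ⟨fun x => h _ _ (Below.root i x), fun x y hxy => h _ _ (Below.child hxy)⟩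
  · intro h x y hxy
    cases hxy with
    | root i x => exact (h i).1 x
    | child hxy => exact (h _).2 _ _ hxy

theorem weight_pos {T : PlaneTree} (x : Node T) : 0 < x.weight := by
  induction x with
  | root k _ => exact Nat.succ_pos k
  | child _ _ ih => exact ih

theorem regions_subtree_ne_zero {T : PlaneTree} (x : Node T) : x.subtree.regions ≠ 0 := by
  induction x with
  | root k c => simp [subtree, regions]
  | child _ _ ih => exact ih

/-- A node is the root or a node of one of the subtrees of the root. -/
def equivOption (k : ℕ) (c : Fin (k + 2) → PlaneTree) :
    Node (node k c) ≃ Option (Σ i, Node (c i)) where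
  toFun
    | root _ _ => none
    | child i x => some ⟨i, x⟩
  invFun
    | none => root k c
    | some p => child p.1 p.2
  left_inv x := by cases x <;> rfl
  right_inv x := by cases x <;> rfl

instance isEmpty_leaf : IsEmpty (Node leaf) := ⟨nofun⟩

instance finite (T : PlaneTree) : Finite (Node T) := by
  induction T with
  | leaf => infer_instance
  | node k c ih => exact Finite.of_equiv _ (equivOption k c).symm

noncomputable instance fintype (T : PlaneTree) : Fintype (Node T) := Fintype.ofFinite _

noncomputable instance decidableEq (T : PlaneTree) : DecidableEq (Node T) := Classical.decEq _

@[to_additive]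
theorem prod_node {M : Type*} [CommMonoid M] {k : ℕ} {c : Fin (k + 2) → PlaneTree}
    (f : Node (node k c) → M) :
    ∏ x, f x = f (root k c) * ∏ i, ∏ x : Node (c i), f (child i x) := by
  rw [← (equivOption k c).symm.prod_comp, Fintype.prod_option, Fintype.prod_sigma]
  rfl

theorem sum_weight (T : PlaneTree) : ∑ x : Node T, x.weight = T.regions := by
  induction T with
  | leaf => exact Finset.sum_of_isEmpty _
  | node k c ih =>
    rw [sum_node, regions]
    exact congrArg _ (Finset.sum_congr rfl fun i _ => ih i)

/-- The labeling with given label of the root and given labelings of the subtrees. -/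
def label {A : Type*} {k : ℕ} {c : Fin (k + 2) → PlaneTree} (a : A) (ℓ : ∀ i, Node (c i) → A) :
    Node (node k c) → A
  | root _ _ => a
  | child i x => ℓ i x

end Node

open Node

theorem prod_map_internalNodes {M : Type*} [CommMonoid M] (f : PlaneTree → M) (T : PlaneTree) :
    (T.internalNodes.map f).prod = ∏ x : Node T, f x.subtree := by
  induction T with
  | leaf => rw [Finset.prod_of_isEmpty]; rfl
  | node k c ih =>
    rw [internalNodes, Multiset.map_cons, Multiset.prod_cons, prod_node, prod_map_multisetSum]
    exact congrArg _ (Finset.prod_congr rfl fun i _ => ih i)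

theorem prod_map_properInternalNodes_node {M : Type*} [CommMonoid M] (f : PlaneTree → M) {k : ℕ}
    (c : Fin (k + 2) → PlaneTree) :
    ((node k c).properInternalNodes.map f).prod = ∏ i, ∏ x : Node (c i), f x.subtree := by
  rw [properInternalNodes, prod_map_multisetSum]
  exact Finset.prod_congr rfl fun i _ => prod_map_internalNodes f (c i)

theorem leaves_eq_regions_add_one (T : PlaneTree) : T.leaves = T.regions + 1 := by
  induction T with
  | leaf => rfl
  | node k c ih =>
    simp only [leaves, regions, ih, Finset.sum_add_distrib, Finset.sum_const, Finset.card_univ,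
      Fintype.card_fin, smul_eq_mul, mul_one]
    omega

/-- The regions of a tree from left to right, each region being represented by the node which
carries it. -/
def regionList : (T : PlaneTree) → List (Node T)
  | leaf => []
  | node k c => [root k c].intercalate (List.ofFn fun i => (regionList (c i)).map (child i))

theorem map_regionList_node {A : Type*} {k : ℕ} {c : Fin (k + 2) → PlaneTree}
    (ℓ : Node (node k c) → A) :
    (regionList (node k c)).map ℓ = [ℓ (root k c)].intercalate
      (List.ofFn fun i => (regionList (c i)).map fun x => ℓ (child i x)) := by
  rw [regionList, map_intercalate_singleton, List.map_ofFn]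
  simp [Function.comp_def]

theorem mem_regionList {T : PlaneTree} (x : Node T) : x ∈ regionList T := by
  induction x with
  | root k c => simp [regionList, mem_intercalate_singleton]
  | child i x ih =>
    rw [regionList, mem_intercalate_singleton]
    exact Or.inl ⟨_, List.mem_ofFn.2 ⟨i, rfl⟩, List.mem_map_of_mem ih⟩

theorem sum_map_regionList {M : Type*} [AddCommMonoid M] {T : PlaneTree} (f : Node T → M) :
    ((regionList T).map f).sum = ∑ x, x.weight • f x := by
  induction T with
  | leaf => simp [regionList]
  | node k c ih =>
    rw [map_regionList_node, sum_intercalate_singleton, List.map_ofFn, List.sum_ofFn, sum_node,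
      List.length_ofFn, add_comm]
    exact congrArg₂ _ rfl (Finset.sum_congr rfl fun i _ => ih i _)

theorem length_regionList (T : PlaneTree) : (regionList T).length = T.regions := by
  have h := sum_map_regionList (T := T) fun _ => 1
  simpa [sum_weight] using h

theorem count_map_regionList {A : Type*} [DecidableEq A] {T : PlaneTree} (ℓ : Node T → A) (a : A) :
    ((regionList T).map ℓ).count a = ∑ x with ℓ x = a, x.weight := by
  have h := sum_map_regionList fun x => if ℓ x = a then 1 else 0
  simp only [smul_eq_mul, mul_ite, mul_one, mul_zero, ← Finset.sum_filter] at h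
  rw [← h]
  generalize regionList T = L
  induction L with
  | nil => rfl
  | cons x L ih => by_cases hx : ℓ x = a <;> simp [hx, ih, add_comm]

theorem toFinset_map_regionList {A : Type*} [DecidableEq A] {T : PlaneTree} (ℓ : Node T → A) :
    ((regionList T).map ℓ).toFinset = Finset.univ.image ℓ := by
  ext a
  simp [mem_regionList]

theorem map_regionList_injective {A : Type*} (T : PlaneTree) :
    Function.Injective fun ℓ : Node T → A => (regionList T).map ℓ := fun _ _ h =>
  funext fun x => List.map_inj_left.1 h x (mem_regionList x)

/-- A labeling of the nodes is strict if it increases strictly from each node to its proper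
ancestors. -/
def IsStrict {A : Type*} [LT A] {T : PlaneTree} (ℓ : Node T → A) : Prop :=
  ∀ x y, Below x y → ℓ x < ℓ y

theorem isStrict_node_iff {A : Type*} [LT A] {k : ℕ} {c : Fin (k + 2) → PlaneTree}
    {ℓ : Node (node k c) → A} :
    IsStrict ℓ ↔ ∀ i, (∀ x, ℓ (child i x) < ℓ (root k c)) ∧ IsStrict fun x => ℓ (child i x) :=
  forall_below_node_iff

theorem decreasing_nil : decreasing [] = leaf := by
  rw [decreasing]
  split <;> simp_all

theorem decreasing_of_max? {u : List ℕ} {m : ℕ} (h : u.max? = some m) :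
    decreasing u = node (u.count m - 1) fun i => decreasing ((u.splitOn m).getD i []) := by
  rw [decreasing]
  split
  · simp_all
  · rename_i m' h'
    obtain rfl : m = m' := Option.some_injective _ (h.symm.trans h')
    rfl

theorem decreasing_intercalate_ofFn {k m : ℕ} {w : Fin (k + 2) → List ℕ}
    (hw : ∀ i, ∀ a ∈ w i, a < m) :
    decreasing ([m].intercalate (List.ofFn w)) = node k fun i => decreasing (w i) := by
  have hnot : ∀ l ∈ List.ofFn w, m ∉ l := by
    intro l hl hml
    obtain ⟨i, rfl⟩ := List.mem_ofFn.1 hl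
    exact lt_irrefl m (hw i m hml)
  have hmax : ([m].intercalate (List.ofFn w)).max? = some m := by
    rw [List.max?_eq_some_iff]
    refine ⟨mem_intercalate_singleton.2 (by simp), fun b hb => ?_⟩
    rcases mem_intercalate_singleton.1 hb with ⟨l, hl, hbl⟩ | ⟨rfl, -⟩
    · obtain ⟨i, rfl⟩ := List.mem_ofFn.1 hl
      exact (hw i b hbl).le
    · exact le_rfl
  have hne : List.ofFn w ≠ [] := by simp
  have hk : ([m].intercalate (List.ofFn w)).count m - 1 = k := by
    rw [count_intercalate_singleton m hnot, List.length_ofFn]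
    rfl
  have hget : ∀ i : Fin (k + 2), (List.ofFn w).getD i [] = w i := fun i => by
    rw [List.getD_eq_getElem _ _ (by rw [List.length_ofFn]; exact i.2), List.getElem_ofFn]
  rw [decreasing_of_max? hmax, List.splitOn_intercalate m hnot hne, hk]
  simp only [hget]

theorem decreasing_map_regionList {T : PlaneTree} {ℓ : Node T → ℕ} (hℓ : IsStrict ℓ) :
    decreasing ((regionList T).map ℓ) = T := by
  induction T with
  | leaf => exact decreasing_nil
  | node k c ih =>
    rw [isStrict_node_iff] at hℓ
    rw [map_regionList_node, decreasing_intercalate_ofFn]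
    · exact congrArg (node k) (funext fun i => ih i (hℓ i).2)
    · intro i a ha
      obtain ⟨x, -, rfl⟩ := List.mem_map.1 ha
      exact (hℓ i).1 x

theorem exists_isStrict_eq_map_regionList {T : PlaneTree} {u : List ℕ} (hu : decreasing u = T) :
    ∃ ℓ : Node T → ℕ, IsStrict ℓ ∧ u = (regionList T).map ℓ := by
  induction T generalizing u with
  | leaf =>
    rcases eq_or_ne u [] with rfl | hne
    · exact ⟨isEmptyElim, isEmptyElim, rfl⟩
    · obtain ⟨m, hm⟩ := Option.isSome_iff_exists.1 (List.isSome_max?_of_ne_nil hne)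
      rw [decreasing_of_max? hm] at hu
      cases hu
  | node k c ih =>
    have hne : u ≠ [] := by
      rintro rfl
      rw [decreasing_nil] at hu
      cases hu
    obtain ⟨m, hm⟩ := Option.isSome_iff_exists.1 (List.isSome_max?_of_ne_nil hne)
    obtain ⟨hmem, hmax⟩ := List.max?_eq_some_iff.1 hm
    obtain ⟨k', w, hw, rfl⟩ := exists_eq_intercalate_ofFn_of_isMax hmem hmax
    rw [decreasing_intercalate_ofFn hw] at hu
    cases hu
    choose ℓ hℓ hwℓ using fun i => ih i rfl
    refine ⟨label m ℓ, isStrict_node_iff.2 fun i => ⟨fun x => ?_, hℓ i⟩, ?_⟩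
    · exact hw i _ (hwℓ i ▸ List.mem_map_of_mem (mem_regionList x))
    · rw [map_regionList_node]
      exact congrArg _ (congrArg List.ofFn (funext hwℓ))

theorem exists_isStrict_map_iff {A B : Type*} [LinearOrder A] [Nonempty A] [LinearOrder B]
    {T : PlaneTree} {u : List A} {f : A → B} (hf : StrictMonoOn f {a | a ∈ u}) :
    (∃ ℓ : Node T → B, IsStrict ℓ ∧ u.map f = (regionList T).map ℓ) ↔
      ∃ ℓ : Node T → A, IsStrict ℓ ∧ u = (regionList T).map ℓ := by
  constructor
  · rintro ⟨ℓ, hℓ, h⟩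
    let g := Function.invFunOn f {a | a ∈ u}
    have hg : ∀ a ∈ u, g (f a) = a := fun a ha => hf.injOn.leftInvOn_invFunOn ha
    have hℓu : ∀ x, ∃ a ∈ u, f a = ℓ x := fun x =>
      List.mem_map.1 (h ▸ List.mem_map_of_mem (mem_regionList x))
    refine ⟨g ∘ ℓ, fun x y hxy => ?_, ?_⟩
    · obtain ⟨a, ha, hax⟩ := hℓu x
      obtain ⟨b, hb, hby⟩ := hℓu y
      have hlt : f a < f b := hax ▸ hby ▸ hℓ x y hxy
      simpa only [Function.comp_apply, ← hax, ← hby, hg a ha, hg b hb] using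
        (hf.lt_iff_lt ha hb).1 hlt
    · calc u = (u.map f).map g := by
            rw [List.map_map]
            exact (List.map_id u).symm.trans (List.map_congr_left fun a ha => (hg a ha).symm)
        _ = (regionList T).map (g ∘ ℓ) := by rw [h, List.map_map]
  · rintro ⟨ℓ, hℓ, rfl⟩
    refine ⟨f ∘ ℓ, fun x y hxy => ?_, List.map_map⟩
    exact hf (List.mem_map_of_mem (mem_regionList x)) (List.mem_map_of_mem (mem_regionList y))
      (hℓ x y hxy)

theorem decreasing_packWord_eq_iff {A : Type*} [LinearOrder A] [Nonempty A] {T : PlaneTree}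
    {u : List A} :
    decreasing (packWord u) = T ↔
      ∃ ℓ : Node T → A, IsStrict ℓ ∧ u = (regionList T).map ℓ := by
  rw [← exists_isStrict_map_iff ((strictMonoOn_card_filter_le u.toFinset).mono fun a ha =>
    List.mem_toFinset.2 ha)]
  refine ⟨exists_isStrict_eq_map_regionList, ?_⟩
  rintro ⟨ℓ, hℓ, h⟩
  rw [packWord, h]
  exact decreasing_map_regionList hℓ

theorem decreasing_packWord_zipWith_eq_iff {A : Type*} [LinearOrder A] [Nonempty A] {T : PlaneTree}
    {x : List A} {w : List ℕ} (h : x.length = w.length) :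
    decreasing (packWord (List.zipWith (fun a b => toLex (a, b)) (packWord x) w)) = T ↔
      ∃ (ξ : Node T → A) (ω : Node T → ℕ), x = (regionList T).map ξ ∧ w = (regionList T).map ω ∧
        IsStrict fun y => toLex (ξ y, ω y) := by
  let f : A → ℕ := fun a => (x.toFinset.filter (· ≤ a)).card
  have hz : List.zipWith (fun a b => toLex (a, b)) (packWord x) w =
      (List.zipWith (fun a b => toLex (a, b)) x w).map
        fun p => toLex (f (ofLex p).1, (ofLex p).2) := by
    rw [packWord, List.map_zipWith, List.zipWith_map_left]
    rfl
  have hf : StrictMonoOn (fun p : A ×ₗ ℕ => toLex (f (ofLex p).1, (ofLex p).2))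
      {p | p ∈ List.zipWith (fun a b => toLex (a, b)) x w} := by
    have hmem : ∀ p ∈ List.zipWith (fun a b => toLex (a, b)) x w, (ofLex p).1 ∈ x.toFinset := by
      intro p hp
      obtain ⟨i, hi, rfl⟩ := List.getElem_of_mem hp
      simp
    intro p hp p' hp' hlt
    rw [Prod.Lex.lt_iff] at hlt ⊢
    exact hlt.imp (fun hlt => strictMonoOn_card_filter_le x.toFinset (hmem p hp) (hmem p' hp') hlt)
      fun heq => ⟨congrArg f heq.1, heq.2⟩
  rw [decreasing_packWord_eq_iff, hz, exists_isStrict_map_iff hf]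
  constructor
  · rintro ⟨ℓ, hℓ, hxw⟩
    obtain ⟨hx, hw⟩ := (zipWith_toLex_eq_map_iff h).1 hxw
    exact ⟨_, _, hx, hw, hℓ⟩
  · rintro ⟨ξ, ω, hx, hw, hstrict⟩
    exact ⟨_, hstrict, (zipWith_toLex_eq_map_iff h).2 ⟨hx, hw⟩⟩

end PlaneTree

theorem mem_packedWords {n : ℕ} {u : PackedWord} : u ∈ packedWords n ↔ u.1.length = n := by
  simp [packedWords]

theorem foldr_max_eq_sup_toFinset (l : List ℕ) : l.foldr max 0 = l.toFinset.sup id := by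
  induction l with
  | nil => rfl
  | cons a l ih => simp [ih]

namespace PackedWord

theorem toFinset_eq_Icc_foldr_max (w : PackedWord) :
    w.1.toFinset = Finset.Icc 1 (w.1.foldr max 0) := by
  obtain ⟨w, k, hk⟩ := w
  have hsup : (Finset.Icc 1 k).sup id = k := by
    refine le_antisymm (Finset.sup_le fun a ha => (Finset.mem_Icc.1 ha).2) ?_
    rcases Nat.eq_zero_or_pos k with rfl | hpos
    · exact Nat.zero_le _
    · exact Finset.le_sup (f := id) (Finset.mem_Icc.2 ⟨hpos, le_rfl⟩)
  rw [foldr_max_eq_sup_toFinset, hk, hsup]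

theorem sum_ev (w : PackedWord) : w.ev.sum = w.1.length := by
  rw [← List.sum_toFinset_count_eq_length, toFinset_eq_Icc_foldr_max, ev]
  generalize w.1.foldr max 0 = k
  induction k with
  | zero => rfl
  | succ k ih =>
    rw [List.range'_1_concat, Finset.sum_Icc_succ_top (by omega), List.map_append, List.sum_append,
      ih]
    simp [add_comm]

theorem pos_of_mem_ev (w : PackedWord) {j : ℕ} (hj : j ∈ w.ev) : 0 < j := by
  simp only [ev, List.mem_map, List.mem_range'_1] at hj
  obtain ⟨a, ha, rfl⟩ := hj
  rw [List.count_pos_iff, ← List.mem_toFinset, toFinset_eq_Icc_foldr_max, Finset.mem_Icc]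
  omega

theorem ev_eq_append_count {w : PackedWord} {k : ℕ} (hk : w.1.foldr max 0 = k + 1) :
    w.ev = ((List.range' 1 k).map fun j => w.1.count j) ++ [w.1.count (k + 1)] := by
  rw [ev, hk, List.range'_1_concat, List.map_append, List.map_singleton, add_comm 1 k]

end PackedWord

namespace NCSym

variable {F : Type*} [Field F]

/-- The composition `(i₁, …, iᵣ)` indexing the basis element `S^I` of `Sym`. -/
abbrev parts (I : FreeMonoid ℕ+) : List ℕ := I.toList.map fun i : ℕ+ => (i : ℕ)

theorem parts_injective : Function.Injective parts :=
  (List.map_injective_iff.2 PNat.coe_injective).comp FreeMonoid.toList.injective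

theorem pos_of_mem_parts {I : FreeMonoid ℕ+} {j : ℕ} (hj : j ∈ parts I) : 0 < j := by
  obtain ⟨i, -, rfl⟩ := List.mem_map.1 hj
  exact i.2

theorem length_le_sum_parts (I : FreeMonoid ℕ+) : I.length ≤ (parts I).sum := by
  simpa [FreeMonoid.length] using
    List.card_nsmul_le_sum (parts I) 1 fun _ h => pos_of_mem_parts h

theorem parts_mul_of (I : FreeMonoid ℕ+) (i : ℕ+) :
    parts (I * FreeMonoid.of i) = parts I ++ [(i : ℕ)] := by
  rw [parts, FreeMonoid.toList_mul, FreeMonoid.toList_of, List.map_append, List.map_singleton]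

theorem exists_parts_eq {L : List ℕ} (hL : ∀ j ∈ L, 0 < j) : ∃ I, parts I = L := by
  refine ⟨FreeMonoid.ofList (L.map Nat.toPNat'), ?_⟩
  rw [parts, FreeMonoid.toList_ofList, List.map_map]
  exact (List.map_congr_left fun j hj => PNat.toPNat'_coe (hL j hj)).trans (List.map_id L)

theorem S_coe (i : ℕ+) : S F i = MonoidAlgebra.single (FreeMonoid.of i) 1 := dif_pos i.2

theorem prod_map_S_parts (I : FreeMonoid ℕ+) :
    ((parts I).map (S F)).prod = MonoidAlgebra.single I 1 := by
  induction I using FreeMonoid.inductionOn' with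
  | one => rfl
  | of_mul i I ih =>
    rw [parts, FreeMonoid.toList_of_mul, List.map_cons, List.map_cons, List.prod_cons, ih, S_coe,
      MonoidAlgebra.single_mul_single, mul_one]

theorem coeff_prod_map_S {L : List ℕ} (hL : ∀ j ∈ L, 0 < j) (J : FreeMonoid ℕ+) :
    (L.map (S F)).prod.coeff J = if L = parts J then 1 else 0 := by
  classical
  obtain ⟨I, rfl⟩ := exists_parts_eq hL
  rw [prod_map_S_parts, MonoidAlgebra.coeff_single, Finsupp.single_apply]
  exact if_congr parts_injective.eq_iff.symm rfl rfl

theorem coeff_Lam (k : ℕ) (J : FreeMonoid ℕ+) :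
    (Lam F k).coeff J = if (parts J).sum = k then (-1) ^ (k - J.length) else 0 := by
  have hsum : (Lam F k).coeff J =
      ∑ I : Composition k, if I.blocks = parts J then (-1 : F) ^ (k - I.length) else 0 := by
    rw [Lam, MonoidAlgebra.coeff_sum, Finsupp.finsetSum_apply]
    refine Finset.sum_congr rfl fun I _ => ?_
    rw [MonoidAlgebra.coeff_smul, Finsupp.smul_apply, coeff_prod_map_S fun _ h => I.blocks_pos h,
      smul_eq_mul, mul_ite, mul_one, mul_zero]
  rw [hsum]
  split_ifs with hk
  · rw [Finset.sum_eq_single ⟨parts J, pos_of_mem_parts, hk⟩]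
    · simp [Composition.length, FreeMonoid.length]
    · exact fun I _ hne => if_neg fun h => hne (Composition.ext h)
    · exact fun h => absurd (Finset.mem_univ _) h
  · exact Finset.sum_eq_zero fun I _ => if_neg fun h => hk ((congrArg _ h.symm).trans I.blocks_sum)

theorem coeff_neg_pow_smul_Lam (t : F) (k : ℕ) (J : FreeMonoid ℕ+) :
    ((-t) ^ k • Lam F k).coeff J = if (parts J).sum = k then (-1) ^ J.length * t ^ k else 0 := by
  rw [MonoidAlgebra.coeff_smul, Finsupp.smul_apply, coeff_Lam, smul_eq_mul, mul_ite, mul_zero]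
  refine if_ctx_congr Iff.rfl (fun hk => ?_) fun _ => rfl
  obtain ⟨d, hd⟩ := Nat.exists_eq_add_of_le (hk ▸ length_le_sum_parts J)
  have hsq : (-1 : F) ^ d * (-1) ^ d = 1 := by rw [← mul_pow]; simp
  rw [hd, Nat.add_sub_cancel_left, neg_pow, pow_add (-1 : F)]
  linear_combination (-1) ^ J.length * t ^ (J.length + d) * hsq

theorem coeff_mul_S (f : NCSym F) (J : FreeMonoid ℕ+) (i : ℕ+) {l : ℕ} (hl : 0 < l) :
    (f * S F l).coeff (J * FreeMonoid.of i) = if (i : ℕ) = l then f.coeff J else 0 := by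
  lift l to ℕ+ using hl
  rw [S_coe]
  split_ifs with h
  · obtain rfl := PNat.coe_injective h
    rw [MonoidAlgebra.coeff_mul_single_mul, mul_one]
  · refine MonoidAlgebra.coeff_mul_single_of_forall_mul_ne _ _ fun I hI => h ?_
    have hparts := congrArg parts hI
    rw [parts_mul_of, parts_mul_of] at hparts
    exact (List.singleton_inj.1 (List.append_inj_right' hparts rfl)).symm

theorem coeff_sigmaOneMinus (t : F) (J : FreeMonoid ℕ+) (i : ℕ+) {n : ℕ}
    (hn : (parts J).sum + i = n) :
    (sigmaOneMinus t n).coeff (J * FreeMonoid.of i) =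
      (-1) ^ (J.length + 1) * (t ^ n - t ^ (n - i)) := by
  have hsum : (parts (J * FreeMonoid.of i)).sum = n := by
    rw [parts_mul_of, List.sum_append, List.sum_singleton, hn]
  have hlow : ∀ k ∈ Finset.range n, ((-t) ^ k • (Lam F k * S F (n - k))).coeff
      (J * FreeMonoid.of i) = if k = n - i then (-1) ^ J.length * t ^ k else 0 := by
    intro k hk
    have hkn := Finset.mem_range.1 hk
    rw [← smul_mul_assoc, coeff_mul_S _ _ _ (Nat.sub_pos_of_lt hkn), coeff_neg_pow_smul_Lam,
      ← ite_and]
    exact if_congr (by omega) rfl rfl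
  have htop : ((-t) ^ n • (Lam F n * S F (n - n))).coeff (J * FreeMonoid.of i) =
      (-1) ^ (J.length + 1) * t ^ n := by
    have hS : S F (n - n) = 1 := by simp [S]
    rw [hS, mul_one, coeff_neg_pow_smul_Lam, if_pos hsum,
      FreeMonoid.length_mul, FreeMonoid.length_of]
  rw [sigmaOneMinus, MonoidAlgebra.coeff_sum, Finsupp.finsetSum_apply, Finset.sum_range_succ,
    Finset.sum_congr rfl hlow, htop, Finset.sum_ite_eq', if_pos]
  · ring
  · exact Finset.mem_range.2 (by have := i.pos; omega)

theorem toWQSymDual_apply (f : NCSym F) {w : PackedWord} {J : FreeMonoid ℕ+}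
    (hJ : parts J = w.ev) : toWQSymDual F f w = f.coeff J := by
  classical
  have hbasis : ∀ I : FreeMonoid ℕ+, (∑ u ∈ packedWords (parts I).sum with u.ev = parts I,
      WQSymDual.N F u) w = if I = J then 1 else 0 := by
    intro I
    simp only [Finsupp.finsetSum_apply, WQSymDual.N, Finsupp.single_apply]
    rw [Finset.sum_ite_eq']
    refine if_congr ?_ rfl rfl
    rw [Finset.mem_filter, mem_packedWords, ← hJ, parts_injective.eq_iff, eq_comm (a := J)]
    refine and_iff_right_of_imp ?_
    rintro rfl
    rw [hJ, PackedWord.sum_ev]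
  rw [toWQSymDual, Finsupp.sum_apply, Finsupp.sum]
  simp only [Finsupp.smul_apply, hbasis, smul_eq_mul, mul_ite, mul_one, mul_zero]
  rw [Finset.sum_ite_eq', ite_eq_left_iff, Finsupp.notMem_support_iff]
  exact Eq.symm

theorem toWQSymDual_sigmaOneMinus_apply (t : F) {w : PackedWord} (hw : w.1 ≠ []) :
    toWQSymDual F (sigmaOneMinus t w.1.length) w = (-1) ^ w.1.foldr max 0 *
      (t ^ w.1.length - t ^ (w.1.length - w.1.count (w.1.foldr max 0))) := by
  obtain ⟨k, hk⟩ : ∃ k, w.1.foldr max 0 = k + 1 := by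
    refine Nat.exists_eq_succ_of_ne_zero fun h => hw ?_
    rw [← List.toFinset_eq_empty_iff, PackedWord.toFinset_eq_Icc_foldr_max, h]
    rfl
  have hev := PackedWord.ev_eq_append_count hk
  have hpos : ∀ j ∈ w.ev, 0 < j := fun j => w.pos_of_mem_ev
  rw [hev] at hpos
  obtain ⟨J, hJ⟩ := exists_parts_eq fun j hj => hpos j (List.mem_append_left _ hj)
  obtain ⟨i, hi⟩ : ∃ i : ℕ+, (i : ℕ) = w.1.count (k + 1) :=
    ⟨⟨_, hpos _ (List.mem_append_right _ List.mem_cons_self)⟩, rfl⟩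
  have hparts : parts (J * FreeMonoid.of i) = w.ev := by rw [parts_mul_of, hJ, hi, hev]
  have hsum : (parts J).sum + i = w.1.length := by
    rw [← w.sum_ev, ← hparts, parts_mul_of, List.sum_append, List.sum_singleton]
  have hlength : J.length = k := by
    simpa [FreeMonoid.length] using congrArg List.length hJ
  rw [toWQSymDual_apply _ hparts, coeff_sigmaOneMinus t J i hsum, hlength, hk, hi]

end NCSym

theorem WQSymDual.NOneMinus_apply {F : Type*} [Field F] (t : F) (u v : PackedWord) :
    WQSymDual.NOneMinus t v u = ∑ w ∈ packedWords v.1.length,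
      if toPacked (List.zipWith (fun x y => toLex (x, y)) v.1 w.1) = u then
        NCSym.toWQSymDual F (NCSym.sigmaOneMinus t v.1.length) w else 0 := by
  rw [WQSymDual.NOneMinus, WQSymDual.internalMul, WQSymDual.N, Finsupp.sum_single_index (by simp),
    Finsupp.sum_apply, Finsupp.sum]
  apply Finset.sum_congr_of_eq_on_inter
  · intro w _ hw
    rw [mem_packedWords] at hw
    rw [if_neg fun h => hw h.symm]
    rfl
  · intro w _ hw
    rw [Finsupp.notMem_support_iff.1 hw, ite_self]
  · intro w _ hw
    rw [mem_packedWords] at hw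
    rw [if_pos hw.symm, one_mul, Finsupp.smul_apply, WQSymDual.N, Finsupp.single_apply,
      smul_eq_mul, mul_ite, mul_one, mul_zero]

namespace WQSym

variable {F : Type*} [Field F]

/-- The packed word of the word `q^{x 0} q^{x 1} ⋯` over the alphabet `{⋯ < q² < q < 1}`. -/
def packedExponents {n : ℕ} (x : Fin n → ℕ) : PackedWord :=
  toPacked (List.ofFn fun i => OrderDual.toDual (x i))

theorem length_packedExponents {n : ℕ} (x : Fin n → ℕ) : (packedExponents x).1.length = n := by
  rw [packedExponents, toPacked, length_packWord, List.length_ofFn]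

theorem coeff_atGeometric_M (m : ℕ) (v : PackedWord) :
    PowerSeries.coeff m (atGeometric F (M F v)) =
      ∑ x ∈ Finset.Nat.antidiagonalTuple v.1.length m, if packedExponents x = v then 1 else 0 := by
  simp only [atGeometric, M, Finsupp.linearCombination_single, one_smul, PowerSeries.coeff_mk,
    realM]
  rfl

theorem coeff_atX_M (t : F) (u : PackedWord) (m : ℕ) :
    PowerSeries.coeff m (atX t (M F u)) =
      ∑ x ∈ Finset.Nat.antidiagonalTuple u.1.length m,
        WQSymDual.NOneMinus t (packedExponents x) u := by
  have hdual : timesOneMinus t (M F u) =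
      ∑ v ∈ packedWords u.1.length, WQSymDual.NOneMinus t v u • M F v := by
    rw [timesOneMinus, M, Finsupp.linearCombination_single, one_smul]
  have hcoeff : ∀ v ∈ packedWords u.1.length, PowerSeries.coeff m (atGeometric F (M F v)) =
      ∑ x ∈ Finset.Nat.antidiagonalTuple u.1.length m, if packedExponents x = v then 1 else 0 := by
    intro v hv
    rw [coeff_atGeometric_M, mem_packedWords.1 hv]
  rw [atX, LinearMap.comp_apply, hdual, map_sum, map_sum]
  simp only [map_smul, smul_eq_mul]
  rw [Finset.sum_congr rfl fun v hv => by rw [hcoeff v hv, Finset.mul_sum], Finset.sum_comm]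
  refine Finset.sum_congr rfl fun x _ => ?_
  simp only [mul_ite, mul_one, mul_zero]
  rw [Finset.sum_ite_eq, if_pos (mem_packedWords.2 (length_packedExponents x))]

open Classical in
theorem coeff_atX_MT (t : F) (T : PlaneTree) (m : ℕ) :
    PowerSeries.coeff m (atX t (PlaneTree.MT F T)) =
      ∑ x ∈ Finset.Nat.antidiagonalTuple T.regions m, ∑ w ∈ packedWords T.regions,
        if PlaneTree.decreasing
          (packWord (List.zipWith (fun a b => toLex (a, b)) (packedExponents x).1 w.1)) = T then
          NCSym.toWQSymDual F (NCSym.sigmaOneMinus t T.regions) w else 0 := by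
  have hcoeff : ∀ u ∈ packedWords T.regions, PowerSeries.coeff m (atX t (M F u)) =
      ∑ x ∈ Finset.Nat.antidiagonalTuple T.regions m, ∑ w ∈ packedWords T.regions,
        if toPacked (List.zipWith (fun a b => toLex (a, b)) (packedExponents x).1 w.1) = u then
          NCSym.toWQSymDual F (NCSym.sigmaOneMinus t T.regions) w else 0 := by
    intro u hu
    simp only [coeff_atX_M, WQSymDual.NOneMinus_apply, length_packedExponents]
    rw [mem_packedWords.1 hu]
  rw [PlaneTree.MT, map_sum, map_sum,
    Finset.sum_congr rfl fun u hu => hcoeff u (Finset.mem_filter.1 hu).1, Finset.sum_comm]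
  refine Finset.sum_congr rfl fun x _ => ?_
  rw [Finset.sum_comm]
  refine Finset.sum_congr rfl fun w hw => ?_
  rw [Finset.sum_ite_eq]
  refine if_congr ?_ rfl rfl
  rw [Finset.mem_filter, mem_packedWords, and_iff_right]
  · rfl
  · rw [toPacked, length_packWord, List.length_zipWith, length_packedExponents,
      mem_packedWords.1 hw, min_self]

end WQSym

section WeightedSums

variable {ι : Type*} [Fintype ι] [DecidableEq ι]

/-- The families of natural numbers `d` with `∑ x, r x * d x = m`. The range of the values is only
there to make the set finite: it is no restriction when the weights `r x` are positive. -/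
def weightedSums (r : ι → ℕ) (m : ℕ) : Finset (ι → ℕ) :=
  (Fintype.piFinset fun _ => Finset.range (m + 1)).filter fun d => ∑ x, r x * d x = m

theorem mem_weightedSums {r : ι → ℕ} (hr : ∀ x, r x ≠ 0) {m : ℕ} {d : ι → ℕ} :
    d ∈ weightedSums r m ↔ ∑ x, r x * d x = m := by
  rw [weightedSums, Finset.mem_filter, Fintype.mem_piFinset]
  refine and_iff_right_of_imp fun hd x => Finset.mem_range_succ_iff.2 ?_
  calc d x ≤ r x * d x := Nat.le_mul_of_pos_left _ (Nat.pos_of_ne_zero (hr x))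
    _ ≤ ∑ x, r x * d x :=
      Finset.single_le_sum (f := fun x => r x * d x) (fun _ _ => Nat.zero_le _) (Finset.mem_univ x)
    _ = m := hd

theorem coeff_prod_expand {R : Type*} [CommRing R] {r : ι → ℕ} (hr : ∀ x, r x ≠ 0)
    (φ : ι → PowerSeries R) (m : ℕ) :
    PowerSeries.coeff m (∏ x, PowerSeries.expand (r x) (hr x) (φ x)) =
      ∑ d ∈ weightedSums r m, ∏ x, PowerSeries.coeff (d x) (φ x) := by
  rw [PowerSeries.coeff_prod]
  symm
  refine Finset.sum_of_injOn (fun d => Finsupp.equivFunOnFinite.symm fun x => r x * d x)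
    ?_ ?_ ?_ ?_
  · intro d _ d' _ h
    funext x
    exact Nat.eq_of_mul_eq_mul_left (Nat.pos_of_ne_zero (hr x)) (DFunLike.congr_fun h x)
  · intro d hd
    rw [Finset.mem_coe, mem_weightedSums hr] at hd
    simpa [Finset.mem_finsuppAntidiag] using hd
  · intro l hl hnot
    obtain ⟨x, hx⟩ : ∃ x, ¬ r x ∣ l x := by
      by_contra! hdvd
      choose d hd using hdvd
      have hsum : ∑ x, r x * d x = m := by
        simpa only [← hd] using (Finset.mem_finsuppAntidiag.1 hl).1
      exact hnot ⟨d, (mem_weightedSums hr).2 hsum, Finsupp.ext fun x => (hd x).symm⟩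
    exact Finset.prod_eq_zero (Finset.mem_univ x) (PowerSeries.coeff_expand_of_not_dvd _ _ _ hx)
  · exact fun d _ => Finset.prod_congr rfl fun x _ =>
      (PowerSeries.coeff_expand_mul (r x) (hr x) (φ x) (d x)).symm

end WeightedSums

section GeometricSeries

variable {F : Type*} [Field F] {r : ℕ}

theorem constantCoeff_one_sub_X_pow_ne_zero (hr : r ≠ 0) :
    PowerSeries.constantCoeff (1 - PowerSeries.X ^ r : PowerSeries F) ≠ 0 := by
  simp [hr]

theorem expand_mk_const (hr : r ≠ 0) (a : F) :
    PowerSeries.expand r hr (PowerSeries.mk fun _ => a) =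
      PowerSeries.C a * (1 - PowerSeries.X ^ r)⁻¹ := by
  have hmk : PowerSeries.mk (fun _ => a) = PowerSeries.C a * PowerSeries.mk 1 := by
    ext n
    simp
  have hgeom : PowerSeries.mk (fun _ => a) * (1 - PowerSeries.X) = PowerSeries.C a := by
    rw [hmk, mul_assoc, PowerSeries.mk_one_mul_one_sub_eq_one, mul_one]
  rw [PowerSeries.eq_mul_inv_iff_mul_eq (constantCoeff_one_sub_X_pow_ne_zero hr)]
  simpa [PowerSeries.expand_X, PowerSeries.expand_C] using
    congrArg (PowerSeries.expand r hr) hgeom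

theorem expand_mk_ite (hr : r ≠ 0) (a : F) :
    PowerSeries.expand r hr (PowerSeries.mk fun e => if e = 0 then -a else 1 - a) =
      (PowerSeries.X ^ r - PowerSeries.C a) * (1 - PowerSeries.X ^ r)⁻¹ := by
  have hmk : PowerSeries.mk (fun e => if e = 0 then -a else 1 - a) =
      PowerSeries.C (1 - a) * PowerSeries.mk 1 - 1 := by
    ext n
    rw [map_sub (PowerSeries.coeff n), PowerSeries.coeff_C_mul, PowerSeries.coeff_mk,
      PowerSeries.coeff_mk, PowerSeries.coeff_one, Pi.one_apply]
    split_ifs <;> ring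
  have hgeom : PowerSeries.mk (fun e => if e = 0 then -a else 1 - a) * (1 - PowerSeries.X) =
      PowerSeries.X - PowerSeries.C a := by
    rw [hmk, sub_mul, mul_assoc, PowerSeries.mk_one_mul_one_sub_eq_one, map_sub, map_one]
    ring
  rw [PowerSeries.eq_mul_inv_iff_mul_eq (constantCoeff_one_sub_X_pow_ne_zero hr)]
  simpa [PowerSeries.expand_X, PowerSeries.expand_C] using
    congrArg (PowerSeries.expand r hr) hgeom

end GeometricSeries

namespace PlaneTree

open Node

/-- A labeling of the nodes is increasing if its labels increase weakly from each node to its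
descendants. -/
def IsIncreasing {T : PlaneTree} (ξ : Node T → ℕ) : Prop :=
  ∀ x y, Below x y → ξ y ≤ ξ x

theorem isIncreasing_node_iff {k : ℕ} {c : Fin (k + 2) → PlaneTree} {ξ : Node (node k c) → ℕ} :
    IsIncreasing ξ ↔
      ∀ i, (∀ x, ξ (root k c) ≤ ξ (child i x)) ∧ IsIncreasing fun x => ξ (child i x) :=
  forall_below_node_iff

/-- The relation between a node and its proper ancestors with the same label. -/
def TiedBelow {T : PlaneTree} (ξ : Node T → ℕ) (x y : Node T) : Prop := Below x y ∧ ξ x = ξ y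

theorem mem_maximals_tiedBelow {T : PlaneTree} {ξ : Node T → ℕ} {x : Node T} :
    x ∈ maximals (TiedBelow ξ) Finset.univ ↔ ∀ y, Below x y → ξ x ≠ ξ y := by
  simp [mem_maximals, TiedBelow]

theorem isStrict_toLex_iff {T : PlaneTree} {ξ ω : Node T → ℕ} :
    (IsStrict fun x => toLex (OrderDual.toDual (ξ x), ω x)) ↔
      IsIncreasing ξ ∧ ∀ x y, TiedBelow ξ x y → ω x < ω y := by
  simp only [IsStrict, IsIncreasing, TiedBelow, Prod.Lex.toLex_lt_toLex, OrderDual.toDual_lt_toDual,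
    EmbeddingLike.apply_eq_iff_eq]
  grind

theorem isPackedWord_map_regionList_iff {T : PlaneTree} {ω : Node T → ℕ} :
    IsPackedWord ((regionList T).map ω) ↔ Finset.univ.image ω = Finset.Icc 1 (height ω) := by
  rw [IsPackedWord, toFinset_map_regionList]
  refine ⟨fun ⟨k, hk⟩ => ?_, fun h => ⟨_, h⟩⟩
  rwa [height_eq_of_image_eq_Icc (fun x hx => absurd (Finset.mem_univ x) hx) hk]

theorem mem_strictPackings_tiedBelow_iff {T : PlaneTree} {ξ ω : Node T → ℕ} :
    ω ∈ strictPackings (TiedBelow ξ) Finset.univ ↔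
      IsPackedWord ((regionList T).map ω) ∧ ∀ x y, TiedBelow ξ x y → ω x < ω y := by
  rw [mem_strictPackings, isPackedWord_map_regionList_iff]
  exact ⟨fun h => ⟨h.image_eq, fun x y => h.lt_of_rel x (Finset.mem_univ x) y (Finset.mem_univ y)⟩,
    fun h => ⟨fun x hx => absurd (Finset.mem_univ x) hx, h.1, fun x _ y _ => h.2 x y⟩⟩

section Coefficients

variable {F : Type*} [Field F]

theorem toWQSymDual_sigmaOneMinus_map_regionList (t : F) {T : PlaneTree} [Nonempty (Node T)]
    {ω : Node T → ℕ} (hω : IsPackedWord ((regionList T).map ω)) :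
    NCSym.toWQSymDual F (NCSym.sigmaOneMinus t T.regions) ⟨(regionList T).map ω, hω⟩ =
      (-1) ^ height ω *
        (∏ x : Node T, t ^ x.weight - ∏ x ∈ Finset.univ \ topLevel ω, t ^ x.weight) := by
  have hne : (regionList T).map ω ≠ [] :=
    List.ne_nil_of_mem (List.mem_map_of_mem (mem_regionList (Classical.arbitrary (Node T))))
  have hheight : ((regionList T).map ω).foldr max 0 = height ω := by
    rw [foldr_max_eq_sup_toFinset, toFinset_map_regionList, Finset.sup_image]
    rfl
  have hlow : T.regions - ((regionList T).map ω).count (height ω) =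
      ∑ x ∈ Finset.univ \ topLevel ω, x.weight := by
    have htop : (Finset.univ.filter fun x => ω x = height ω) = topLevel ω := by
      ext
      simp [mem_topLevel]
    rw [count_map_regionList, htop, ← sum_weight,
      ← Finset.sum_sdiff (Finset.subset_univ (topLevel ω)), Nat.add_sub_cancel]
  have happly := NCSym.toWQSymDual_sigmaOneMinus_apply t (w := ⟨_, hω⟩) hne
  rw [List.length_map, length_regionList, hheight, hlow] at happly
  rw [happly, Finset.prod_pow_eq_pow_sum, Finset.prod_pow_eq_pow_sum, sum_weight]

open Classical in
theorem sum_packedWords_decreasing_map_regionList (t : F) {T : PlaneTree} [Nonempty (Node T)]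
    {ξ : Node T → ℕ} (hξ : IsIncreasing ξ) :
    (∑ w ∈ packedWords T.regions,
      if decreasing (packWord (List.zipWith (fun a b => toLex (a, b))
        (packWord ((regionList T).map fun x => OrderDual.toDual (ξ x))) w.1)) = T then
        NCSym.toWQSymDual F (NCSym.sigmaOneMinus t T.regions) w else 0) =
      ∏ x, if x ∈ maximals (TiedBelow ξ) Finset.univ then 1 - t ^ x.weight
        else -t ^ x.weight := by
  have hpacked : ∀ ω ∈ strictPackings (TiedBelow ξ) Finset.univ,
      IsPackedWord ((regionList T).map ω) :=
    fun ω hω => (mem_strictPackings_tiedBelow_iff.1 hω).1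
  have hlength : ∀ ω : Node T → ℕ, ((regionList T).map fun x => OrderDual.toDual (ξ x)).length =
      ((regionList T).map ω).length := fun ω => by simp only [List.length_map]
  have hR : WellFounded (Function.swap (TiedBelow ξ)) :=
    Subrelation.wf And.left (wellFounded_swap_below T)
  rw [← sum_strictPackings_neg_one_pow_mul_sub hR Finset.univ_nonempty, ← Finset.sum_filter]
  symm
  refine Finset.sum_bij (fun ω hω => ⟨(regionList T).map ω, hpacked ω hω⟩) ?_ ?_ ?_ ?_
  · intro ω hω
    rw [Finset.mem_filter, mem_packedWords, decreasing_packWord_zipWith_eq_iff (hlength ω)]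
    exact ⟨by rw [List.length_map, length_regionList], _, ω, rfl, rfl,
      isStrict_toLex_iff.2 ⟨hξ, (mem_strictPackings_tiedBelow_iff.1 hω).2⟩⟩
  · exact fun ω _ ω' _ h => map_regionList_injective T (congrArg Subtype.val h)
  · intro w hw
    obtain ⟨hlen, hdec⟩ := Finset.mem_filter.1 hw
    obtain ⟨ξ', ω, hξ', hω, hstrict⟩ := (decreasing_packWord_zipWith_eq_iff
      (by rw [List.length_map, length_regionList, mem_packedWords.1 hlen])).1 hdec
    obtain rfl := map_regionList_injective T hξ'
    exact ⟨ω, mem_strictPackings_tiedBelow_iff.2 ⟨hω ▸ w.2, (isStrict_toLex_iff.1 hstrict).2⟩,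
      Subtype.ext hω.symm⟩
  · exact fun ω hω => (toWQSymDual_sigmaOneMinus_map_regionList t (hpacked ω hω)).symm

/-- The node carrying the `i`-th region from the left. -/
def regionNode (T : PlaneTree) (i : Fin T.regions) : Node T :=
  (regionList T).get (i.cast (length_regionList T).symm)

theorem ofFn_comp_regionNode {A : Type*} {T : PlaneTree} (ξ : Node T → A) :
    List.ofFn (ξ ∘ regionNode T) = (regionList T).map ξ :=
  List.ext_getElem (by simp [length_regionList]) fun i _ _ => by simp [regionNode]

theorem sum_comp_regionNode {T : PlaneTree} (ξ : Node T → ℕ) :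
    ∑ i, ξ (regionNode T i) = ∑ x, x.weight * ξ x := by
  refine Eq.trans ?_ (sum_map_regionList ξ)
  rw [← ofFn_comp_regionNode, List.sum_ofFn]
  rfl

theorem coeff_atX_MT_eq_sum_weightedSums (t : F) (T : PlaneTree) [Nonempty (Node T)] (m : ℕ) :
    open Classical in
    PowerSeries.coeff m (WQSym.atX t (MT F T)) =
      ∑ ξ ∈ weightedSums (weight (T := T)) m with IsIncreasing ξ,
        ∏ x, if x ∈ maximals (TiedBelow ξ) Finset.univ then 1 - t ^ x.weight
          else -t ^ x.weight := by
  classical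
  have hweight : ∀ x : Node T, x.weight ≠ 0 := fun x => x.weight_pos.ne'
  have hexp : ∀ ξ : Node T → ℕ, (WQSym.packedExponents (ξ ∘ regionNode T)).1 =
      packWord ((regionList T).map fun x => OrderDual.toDual (ξ x)) :=
    fun ξ => congrArg packWord (ofFn_comp_regionNode fun x => OrderDual.toDual (ξ x))
  rw [WQSym.coeff_atX_MT]
  symm
  refine Finset.sum_of_injOn (· ∘ regionNode T) ?_ ?_ ?_ ?_
  · intro ξ _ ξ' _ h
    apply map_regionList_injective T
    simp only [← ofFn_comp_regionNode]
    exact congrArg List.ofFn h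
  · intro ξ hξ
    rw [Finset.mem_coe, Finset.mem_filter, mem_weightedSums hweight] at hξ
    rw [Finset.mem_coe, Finset.Nat.mem_antidiagonalTuple]
    exact (sum_comp_regionNode ξ).trans hξ.1
  · intro x hx hnot
    refine Finset.sum_eq_zero fun w hw => if_neg fun hdec => hnot ?_
    obtain ⟨ξ, ω, hξ, -, hstrict⟩ := (decreasing_packWord_zipWith_eq_iff
      (by rw [List.length_ofFn, mem_packedWords.1 hw])).1 hdec
    have hcomp : (OrderDual.ofDual ∘ ξ) ∘ regionNode T = x := by
      rw [← ofFn_comp_regionNode] at hξ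
      exact (List.ofFn_injective hξ).symm
    refine ⟨OrderDual.ofDual ∘ ξ, ?_, hcomp⟩
    rw [Finset.mem_coe, Finset.mem_filter, mem_weightedSums hweight, ← sum_comp_regionNode,
      ← Finset.Nat.mem_antidiagonalTuple]
    rw [← hcomp] at hx
    exact ⟨hx, (isStrict_toLex_iff.1 hstrict).1⟩
  · intro ξ hξ
    simp only [hexp]
    exact (sum_packedWords_decreasing_map_regionList t (Finset.mem_filter.1 hξ).2).symm

end Coefficients

section SuccessiveDifferences

/-- The labeling whose value at a node is the sum of `d` over the path from the root to this node.
The labeling `d` consists of the successive differences of the resulting increasing labeling. -/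
def accumulate : {T : PlaneTree} → (Node T → ℕ) → Node T → ℕ
  | node k c, d, root _ _ => d (root k c)
  | node k c, d, child i x => d (root k c) + accumulate (fun y : Node (c i) => d (child i y)) x

theorem isIncreasing_accumulate {T : PlaneTree} (d : Node T → ℕ) : IsIncreasing (accumulate d) := by
  induction T with
  | leaf => exact nofun
  | node k c ih =>
    refine isIncreasing_node_iff.2 fun i => ⟨fun x => Nat.le_add_right _ _, fun x y hxy => ?_⟩
    exact Nat.add_le_add_left (ih i _ x y hxy) _

theorem accumulate_injective (T : PlaneTree) :
    Function.Injective (accumulate : (Node T → ℕ) → Node T → ℕ) := by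
  intro d d' h
  induction T with
  | leaf => exact Subsingleton.elim _ _
  | node k c ih =>
    have hroot : d (root k c) = d' (root k c) := congrFun h (root k c)
    have hchild : ∀ i, (fun x => d (child i x)) = fun x => d' (child i x) := by
      refine fun i => ih i (funext fun x => ?_)
      have hx := congrFun h (child i x)
      rwa [accumulate, accumulate, hroot, Nat.add_left_cancel_iff] at hx
    funext x
    cases x with
    | root => exact hroot
    | child i x => exact congrFun (hchild i) x

theorem IsIncreasing.exists_accumulate_eq {T : PlaneTree} {ξ : Node T → ℕ} (hξ : IsIncreasing ξ) :
    ∃ d, accumulate d = ξ := by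
  induction T with
  | leaf => exact ⟨ξ, Subsingleton.elim _ _⟩
  | node k c ih =>
    rw [isIncreasing_node_iff] at hξ
    have hsub : ∀ i, IsIncreasing fun x => ξ (child i x) - ξ (root k c) :=
      fun i x y hxy => Nat.sub_le_sub_right ((hξ i).2 x y hxy) _
    choose d hd using fun i => ih i (hsub i)
    refine ⟨label (ξ (root k c)) d, funext fun x => ?_⟩
    cases x with
    | root => rfl
    | child i x =>
      exact (congrArg _ (congrFun (hd i) x)).trans (Nat.add_sub_cancel' ((hξ i).1 x))

/-- Summation by parts: the difference at a node contributes to the labels of the whole subtree. -/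
theorem sum_weight_mul_accumulate {T : PlaneTree} (d : Node T → ℕ) :
    ∑ x, x.weight * accumulate d x = ∑ x, x.subtree.regions * d x := by
  induction T with
  | leaf => simp only [Finset.sum_of_isEmpty]
  | node k c ih =>
    have hchild : ∀ i, ∑ x : Node (c i), (child i x).weight * accumulate d (child i x) =
        (c i).regions * d (root k c) +
          ∑ x : Node (c i), (child i x).subtree.regions * d (child i x) := by
      intro i
      rw [← sum_weight, Finset.sum_mul]
      refine Eq.trans ?_ (congrArg _ (ih i fun x => d (child i x)))
      rw [← Finset.sum_add_distrib]
      exact Finset.sum_congr rfl fun x _ => Nat.mul_add _ _ _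
    rw [sum_node, sum_node, Finset.sum_congr rfl fun i _ => hchild i, Finset.sum_add_distrib,
      ← Finset.sum_mul, ← Nat.add_assoc]
    exact congrArg (· + _) (Nat.add_mul _ _ _).symm

theorem forall_child_below_iff {k : ℕ} {c : Fin (k + 2) → PlaneTree} {i : Fin (k + 2)}
    {x : Node (c i)} {P : Node (node k c) → Prop} :
    (∀ y, Below (child i x) y → P y) ↔
      P (root k c) ∧ ∀ y, Below x y → P (child i y) := by
  refine ⟨fun h => ⟨h _ (Below.root i x), fun y hy => h _ (Below.child hy)⟩, fun h y hy => ?_⟩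
  cases hy with
  | root => exact h.1
  | child hy => exact h.2 _ hy

theorem root_mem_maximals_tiedBelow {k : ℕ} {c : Fin (k + 2) → PlaneTree}
    (ξ : Node (node k c) → ℕ) : root k c ∈ maximals (TiedBelow ξ) Finset.univ :=
  mem_maximals_tiedBelow.2 nofun

theorem accumulate_ne_zero_and_mem_maximals_iff {T : PlaneTree} {d : Node T → ℕ} {x : Node T} :
    accumulate d x ≠ 0 ∧ x ∈ maximals (TiedBelow (accumulate d)) Finset.univ ↔ d x ≠ 0 := by
  simp only [mem_maximals_tiedBelow]
  induction x with
  | root k c => exact and_iff_left nofun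
  | child i x ih =>
    rw [forall_child_below_iff, ← ih (d := fun y => d (child i y))]
    simp only [accumulate]
    grind

theorem child_mem_maximals_tiedBelow_accumulate_iff {k : ℕ} {c : Fin (k + 2) → PlaneTree}
    {d : Node (node k c) → ℕ} {i : Fin (k + 2)} {x : Node (c i)} :
    child i x ∈ maximals (TiedBelow (accumulate d)) Finset.univ ↔ d (child i x) ≠ 0 := by
  refine ⟨fun hx => ?_, fun hd => (accumulate_ne_zero_and_mem_maximals_iff.2 hd).2⟩
  refine accumulate_ne_zero_and_mem_maximals_iff.1 ⟨fun hzero => ?_, hx⟩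
  have hroot : accumulate d (root k c) ≤ accumulate d (child i x) :=
    isIncreasing_accumulate d _ _ (Below.root i x)
  refine mem_maximals_tiedBelow.1 hx _ (Below.root i x) ?_
  omega

end SuccessiveDifferences

section Coefficients

variable {F : Type*} [Field F]

theorem coeff_atX_MT_eq_sum_accumulate (t : F) (T : PlaneTree) [Nonempty (Node T)] (m : ℕ) :
    PowerSeries.coeff m (WQSym.atX t (MT F T)) =
      ∑ d ∈ weightedSums (fun x : Node T => x.subtree.regions) m,
        ∏ x, if x ∈ maximals (TiedBelow (accumulate d)) Finset.univ then 1 - t ^ x.weight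
          else -t ^ x.weight := by
  classical
  have hmem : ∀ d : Node T → ℕ, d ∈ weightedSums (fun x => x.subtree.regions) m ↔
      accumulate d ∈ weightedSums weight m := fun d => by
    rw [mem_weightedSums regions_subtree_ne_zero, mem_weightedSums fun x => x.weight_pos.ne',
      sum_weight_mul_accumulate]
  rw [coeff_atX_MT_eq_sum_weightedSums]
  symm
  refine Finset.sum_nbij accumulate ?_ (accumulate_injective T).injOn ?_ fun d _ => rfl
  · exact fun d hd => Finset.mem_filter.2 ⟨(hmem d).1 hd, isIncreasing_accumulate d⟩
  · intro ξ hξ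
    obtain ⟨hsum, hincr⟩ := Finset.mem_filter.1 hξ
    obtain ⟨d, rfl⟩ := hincr.exists_accumulate_eq
    exact ⟨d, (hmem d).2 hsum, rfl⟩

theorem atX_MT_node (t : F) (k : ℕ) (c : Fin (k + 2) → PlaneTree) :
    WQSym.atX t (MT F (node k c)) =
      PowerSeries.expand _ (regions_subtree_ne_zero (root k c))
          (PowerSeries.mk fun _ => 1 - t ^ (k + 1)) *
        ∏ i, ∏ x : Node (c i), PowerSeries.expand _ (regions_subtree_ne_zero x)
          (PowerSeries.mk fun e => if e = 0 then -t ^ x.weight else 1 - t ^ x.weight) := by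
  let φ : Node (node k c) → PowerSeries F :=
    label (PowerSeries.mk fun _ => 1 - t ^ (k + 1)) fun i x =>
      PowerSeries.mk fun e => if e = 0 then -t ^ x.weight else 1 - t ^ x.weight
  have hφ : WQSym.atX t (MT F (node k c)) =
      ∏ x, PowerSeries.expand _ (regions_subtree_ne_zero x) (φ x) := by
    have : Nonempty (Node (node k c)) := ⟨root k c⟩
    ext m
    rw [coeff_atX_MT_eq_sum_accumulate, coeff_prod_expand]
    refine Finset.sum_congr rfl fun d _ => Finset.prod_congr rfl fun x _ => ?_
    cases x with
    | root =>
      rw [if_pos (root_mem_maximals_tiedBelow _)]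
      simp only [φ, label, PowerSeries.coeff_mk]
      rfl
    | child i x =>
      simp only [child_mem_maximals_tiedBelow_accumulate_iff, ite_not, φ, label,
        PowerSeries.coeff_mk]
      rfl
  rw [hφ, prod_node]
  rfl

end Coefficients

end PlaneTree

theorem mainTheorem12 {F : Type*} [Field F] (t : F) (T : PlaneTree) (n : ℕ)
    (hn : T.regions = n) (hpos : 1 ≤ n) :
    WQSym.atX t (PlaneTree.MT F T) =
      PowerSeries.C (1 - t ^ (T.arity - 1)) * (1 - PowerSeries.X ^ n)⁻¹ *
        (T.properInternalNodes.map fun i =>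
          (PowerSeries.X ^ i.regions - PowerSeries.C (t ^ (i.arity - 1))) *
            (1 - PowerSeries.X ^ (i.leaves - 1))⁻¹).prod := by
  subst hn
  cases T with
  | leaf => exact absurd hpos (Nat.not_succ_le_zero 0)
  | node k c =>
    have hleaves : ∀ T : PlaneTree, T.leaves - 1 = T.regions := fun T => by
      rw [PlaneTree.leaves_eq_regions_add_one, Nat.add_sub_cancel]
    rw [PlaneTree.atX_MT_node, expand_mk_const, PlaneTree.prod_map_properInternalNodes_node]
    simp only [expand_mk_ite, hleaves]
    rfl
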